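/- Let $0\le k\le n$, let $\Omega\subset\mathbb R^n$ be open, and let $\mathcal G_h$ be a cubical mesh of $\Omega$: a finite set of nondegenerate axis-parallel boxes $K$ whose interiors $K^\circ$ are pairwise disjoint and contained in $\Omega$ and which cover $\Omega$. Differential forms are written $\omega=\sum_{|\sigma|=m}\omega_\sigma\,dx^\sigma$ with increasing multi-indices $\sigma$, and $\langle\omega,\eta\rangle_{L^2\Lambda^m(U)}=\int_U\sum_\sigma\omega_\sigma\eta_\sigma$. Let $\star$ be the Hodge star, $d^m$ the exterior derivative on $m$-forms, and $\delta_m=(-1)^{n(m+1)+1}\star d^{\,n-m}\star$ the codifferential, i.e. the formal adjoint of $d^{m-1}$; let $\kappa$ be the Koszul operator, $\kappa(dx^{\alpha_1}\wedge\dots\wedge dx^{\alpha_m})=\sum_{j}(-1)^{j+1}x_{\alpha_j}\,dx^{\alpha_1}\wedge\dots\widehat{dx^{\alpha_j}}\dots\wedge dx^{\alpha_m}$. For open $U$, $H\Lambda^m(U)$ (resp. $H^*\Lambda^m(U)$) is the space of $L^2$ $m$-forms on $U$ whose weak $d^m$ (resp. weak $\delta_m$) is in $L^2$; $H_0\Lambda^m(U)$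 and $H_0^*\Lambda^m(U)$ are the closures of $C_0^\infty\Lambda^m(U)$ in the respective graph norms. For a cell $K$, spaces and operators on $K$ are those on $K^\circ$. Let $\mathcal P_0\Lambda^m$ be the constant $m$-forms, and $$\mathcal P_1^-\Lambda^m=\mathcal P_0\Lambda^m+\kappa(\mathcal P_0\Lambda^{m+1}),\qquad \mathcal Q_1^-\Lambda^m=\bigoplus_{|\alpha|=m}\Big[\bigotimes_{i=1}^n\mathcal P_{1-\delta_{i,\alpha}}\Big]dx^\alpha,$$ where $\delta_{i,\alpha}=1$ if $i\in\alpha$ and $0$ otherwise; and $\mathcal P_1^{*,-}\Lambda^m=\star\mathcal P_1^-\Lambda^{n-m}$, $\mathcal Q_1^{*,-}\Lambda^m=\star\mathcal Q_1^-\Lambda^{n-m}$ for $m\le n$ (both $\{0\}$ for $m>n$). Put $\mathcal P_1^-\Lambda^k(\mathcal G_h)=\prod_{K\in\mathcal G_h}\mathcal P_1^-\Lambda^k(K)$. Let $V_h^{\mathcal Q}\Lambda^k$ (resp. $V_{h0}^{\mathcal Q}\Lambda^k$) be the space of $\omega\in H\Lambda^k(\Omega)$ (resp. $H_0\Lambda^k(\Omega)$)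 with $\omega|_K\in\mathcal Q_1^-\Lambda^k(K)$ for all $K\in\mathcal G_h$, and let $V_h^{\mathcal Q,*}\Lambda^{k+1}$ (resp. $V_{h0}^{\mathcal Q,*}\Lambda^{k+1}$) be the space of $\mu\in H^*\Lambda^{k+1}(\Omega)$ (resp. $H_0^*\Lambda^{k+1}(\Omega)$) with $\mu|_K\in\mathcal Q_1^{*,-}\Lambda^{k+1}(K)$ for all $K\in\mathcal G_h$. With $$b_K(\omega,\mu)=\langle d^k\omega,\mu\rangle_{L^2\Lambda^{k+1}(K)}-\langle\omega,\delta_{k+1}\mu\rangle_{L^2\Lambda^k(K)},$$ let $$W_h^{\rm def}\Lambda^k=\Big\{\omega_h\in\mathcal P_1^-\Lambda^k(\mathcal G_h):\ \sum_{K\in\mathcal G_h}b_K(\omega_h|_K,\mu_h|_K)=0\ \ \forall\mu_h\in V_{h0}^{\mathcal Q,*}\Lambda^{k+1}\Big\},$$ and let $W_{h0}^{\rm def}\Lambda^k$ be defined in the same way with $V_h^{\mathcal Q,*}\Lambda^{k+1}$ in place of $V_{h0}^{\mathcal Q,*}\Lambda^{k+1}$. For every cell $K$ and every $\omega\in H\Lambda^k(K)$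 there is exactly one $\eta=:\mathbb I_K^{d^k}\omega\in\mathcal P_1^-\Lambda^k$ with $b_K(\eta,\mu)=b_K(\omega,\mu)$ for all $\mu\in\mathcal P_1^{*,-}\Lambda^{k+1}$, where for $k=n$ (when this condition is empty) $\eta$ is instead required to be the $L^2$ projection of $\omega$ to $\mathcal P_0\Lambda^n$. Define $\mathbb I_h^{d^k}$ cell by cell by $(\mathbb I_h^{d^k}\omega)|_K=\mathbb I_K^{d^k}(\omega|_K)$. Then $$\mathbb I_h^{d^k}\big(V_h^{\mathcal Q}\Lambda^k\big)\subset W_h^{\rm def}\Lambda^k\qquad\text{and}\qquad \mathbb I_h^{d^k}\big(V_{h0}^{\mathcal Q}\Lambda^k\big)\subset W_{h0}^{\rm def}\Lambda^k .$$ -/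

import Mathlib

open MeasureTheory


noncomputable section

namespace CubicalWhitney

/-- Exterior forms on `ℝⁿ`, by their coefficients with respect to the basis `dx^σ`, where an
increasing multi-index `σ` is identified with the finite set of its entries. -/
abbrev Cov (n : ℕ) : Type := Finset (Fin n) → ℝ

/-- Differential forms on `ℝⁿ` (of mixed degree), `ω x σ` being the coefficient of `dx^σ` at `x`.
A form on a subset `U` is represented by such a function, of which only the values on `U` matter. -/
abbrev Form (n : ℕ) : Type := (Fin n → ℝ) → Cov n

variable {n : ℕ}

/-- `ω` is a `k`-form: only the `dx^σ` with `|σ| = k` occur. -/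
def IsDeg (k : ℕ) (ω : Form n) : Prop := ∀ x σ, σ.card ≠ k → ω x σ = 0

/-- The sign with `dx^i ∧ dx^(σ \ {i}) = insSign i σ • dx^(σ ∪ {i})`. -/
def insSign (i : Fin n) (σ : Finset (Fin n)) : ℝ := (-1) ^ (σ.filter (fun j => j < i)).card

/-- The sign with `dx^σ ∧ dx^(σᶜ) = starSign σ • dx^1 ∧ ⋯ ∧ dx^n`: the parity of the number of
pairs `(i, j)` with `i ∈ σ`, `j ∉ σ` and `j < i`. -/
def starSign (σ : Finset (Fin n)) : ℝ :=
  (-1) ^ ((σ ×ˢ σᶜ).filter (fun p => p.2 < p.1)).card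

/-- The Hodge star: `⋆ (f dx^σ) = starSign σ • f dx^(σᶜ)`. -/
def hodge : Form n →ₗ[ℝ] Form n where
  toFun ω := fun x τ => starSign τᶜ * ω x τᶜ
  map_add' ω η := by funext x τ; simp [mul_add]
  map_smul' c ω := by funext x τ; simp [mul_left_comm]

/-- The Koszul operator:
`κ (f dx^ρ) = ∑_{i ∈ ρ} (-1)^{#{j ∈ ρ | j < i}} x_i f dx^(ρ \ {i})`. -/
def koszul : Form n →ₗ[ℝ] Form n where
  toFun ω := fun x σ => ∑ i ∈ σᶜ, insSign i σ * x i * ω x (insert i σ)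
  map_add' ω η := by funext x τ; simp [mul_add, Finset.sum_add_distrib]
  map_smul' c ω := by funext x τ; simp [mul_left_comm, Finset.mul_sum]

/-- The classical exterior derivative: `d (f dx^σ) = ∑ᵢ (∂ᵢ f) dx^i ∧ dx^σ`. -/
def extd (ω : Form n) : Form n := fun x ρ =>
  ∑ i ∈ ρ, insSign i ρ * fderiv ℝ (fun y => ω y (ρ.erase i)) x (Pi.single i 1)

/-- The classical codifferential `δ_m = (-1)^(n(m+1)+1) ⋆ d ⋆` of an `m`-form, the sign being the
one for which `δ_m` is the formal adjoint of `d` on `(m-1)`-forms. -/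
def codiff (m : ℕ) (ω : Form n) : Form n := (-1 : ℝ) ^ (n * (m + 1) + 1) • hodge (extd (hodge ω))

/-- The inner product of `L²Λ(U)`. -/
def ip (U : Set (Fin n → ℝ)) (ω η : Form n) : ℝ := ∫ x in U, ∑ σ, ω x σ * η x σ

/-- `L²Λ^k(U)`: `k`-forms with square-integrable coefficients. -/
def MemL2 (k : ℕ) (U : Set (Fin n → ℝ)) (ω : Form n) : Prop :=
  IsDeg k ω ∧ ∀ σ, MemLp (fun x => ω x σ) 2 (volume.restrict U)

/-- `C₀^∞Λ^k(U)`. -/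
def IsTest (k : ℕ) (U : Set (Fin n → ℝ)) (φ : Form n) : Prop :=
  IsDeg k φ ∧ ContDiff ℝ (⊤ : ℕ∞) φ ∧ HasCompactSupport φ ∧ tsupport φ ⊆ U

/-- `η ∈ L²Λ^(k+1)(U)` is the weak exterior derivative of the `k`-form `ω` on `U`. -/
def IsWeakD (k : ℕ) (U : Set (Fin n → ℝ)) (ω η : Form n) : Prop :=
  MemL2 (k + 1) U η ∧ ∀ φ, IsTest (k + 1) U φ → ip U η φ = ip U ω (codiff (k + 1) φ)

/-- `ν ∈ L²Λ^k(U)` is the weak codifferential of the `(k+1)`-form `μ` on `U`. -/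
def IsWeakCod (k : ℕ) (U : Set (Fin n → ℝ)) (μ ν : Form n) : Prop :=
  MemL2 k U ν ∧ ∀ φ, IsTest k U φ → ip U ν φ = ip U μ (extd φ)

/-- `HΛ^k(U)`. -/
def HL (k : ℕ) (U : Set (Fin n → ℝ)) : Set (Form n) :=
  {ω | MemL2 k U ω ∧ ∃ η, IsWeakD k U ω η}

/-- `H^*Λ^(k+1)(U)`, the domain of `δ_(k+1)`. -/
def HsL (k : ℕ) (U : Set (Fin n → ℝ)) : Set (Form n) :=
  {μ | MemL2 (k + 1) U μ ∧ ∃ ν, IsWeakCod k U μ ν}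

open Classical in
/-- The operator `d^k` on `HΛ^k(U)` (the weak derivative is unique almost everywhere on an
open `U`); zero outside `HΛ^k(U)`. -/
def wd (k : ℕ) (U : Set (Fin n → ℝ)) (ω : Form n) : Form n :=
  if h : ∃ η, IsWeakD k U ω η then h.choose else 0

open Classical in
/-- The operator `δ_(k+1)` on `H^*Λ^(k+1)(U)`; zero outside `H^*Λ^(k+1)(U)`. -/
def wcod (k : ℕ) (U : Set (Fin n → ℝ)) (μ : Form n) : Form n :=
  if h : ∃ ν, IsWeakCod k U μ ν then h.choose else 0

/-- `H₀Λ^k(U)`: the closure of `C₀^∞Λ^k(U)` in `HΛ^k(U)` with respect to the graph norm. -/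
def HL0 (k : ℕ) (U : Set (Fin n → ℝ)) : Set (Form n) :=
  {ω | ω ∈ HL k U ∧ ∀ ε : ℝ, 0 < ε → ∃ φ, IsTest k U φ ∧
    ip U (ω - φ) (ω - φ) + ip U (wd k U ω - extd φ) (wd k U ω - extd φ) < ε}

/-- `H₀^*Λ^(k+1)(U)`: the closure of `C₀^∞Λ^(k+1)(U)` in `H^*Λ^(k+1)(U)`. -/
def HsL0 (k : ℕ) (U : Set (Fin n → ℝ)) : Set (Form n) :=
  {μ | μ ∈ HsL k U ∧ ∀ ε : ℝ, 0 < ε → ∃ φ, IsTest (k + 1) U φ ∧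
    ip U (μ - φ) (μ - φ)
      + ip U (wcod k U μ - codiff (k + 1) φ) (wcod k U μ - codiff (k + 1) φ) < ε}

/-- `⟨d^k ω, μ⟩ - ⟨ω, δ_(k+1) μ⟩` on `U`. -/
def pairing (k : ℕ) (U : Set (Fin n → ℝ)) (ω μ : Form n) : ℝ :=
  ip U (wd k U ω) μ - ip U ω (wcod k U μ)

/-- `𝒫₀Λ^k`: `k`-forms with constant coefficients. -/
def P0 (n k : ℕ) : Submodule ℝ (Form n) where
  carrier := {ω | IsDeg k ω ∧ ∃ c : Cov n, ω = fun _ => c}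
  add_mem' := by
    rintro _ _ ⟨ha, a, rfl⟩ ⟨hb, b, rfl⟩
    exact ⟨fun x σ h => show a σ + b σ = 0 by
      rw [show a σ = 0 from ha x σ h, show b σ = 0 from hb x σ h, add_zero], a + b, rfl⟩
  zero_mem' := ⟨fun _ _ _ => rfl, 0, rfl⟩
  smul_mem' := by
    rintro r _ ⟨ha, a, rfl⟩
    exact ⟨fun x σ h => by simpa using Or.inr (ha x σ h), r • a, rfl⟩

/-- The Whitney forms `𝒫₁⁻Λ^k = 𝒫₀Λ^k + κ 𝒫₀Λ^(k+1)`. -/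
def P1m (n k : ℕ) : Submodule ℝ (Form n) := P0 n k ⊔ (P0 n (k + 1)).map koszul

/-- `𝒫₁^{*,-}Λ^k = ⋆ 𝒫₁⁻Λ^(n-k)`; there are no nonzero `k`-forms for `k > n`. -/
def P1s (n k : ℕ) : Submodule ℝ (Form n) := if k ≤ n then (P1m n (n - k)).map hodge else ⊥

/-- `𝒬₁⁻Λ^k`: the sum over `|α| = k` of the spaces `[⨂ᵢ 𝒫_{1-δ(i,α)}] dx^α`, where `δ(i,α)` is `1`
if `i ∈ α` and `0` otherwise. -/
def Q1m (n k : ℕ) : Submodule ℝ (Form n) :=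
  Submodule.span ℝ {ω | ∃ (α : Finset (Fin n)) (p : Fin n → Polynomial ℝ), α.card = k ∧
    (∀ i, (p i).natDegree ≤ if i ∈ α then 0 else 1) ∧
    ω = fun x => Pi.single α (∏ i, (p i).eval (x i))}

/-- `𝒬₁^{*,-}Λ^k = ⋆ 𝒬₁⁻Λ^(n-k)`; there are no nonzero `k`-forms for `k > n`. -/
def Q1s (n k : ℕ) : Submodule ℝ (Form n) := if k ≤ n then (Q1m n (n - k)).map hodge else ⊥

/-- The open box with the same corners as `K`. -/
abbrev cellInterior (K : BoxIntegral.Box (Fin n)) : Set (Fin n → ℝ) := BoxIntegral.Box.Ioo K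

/-- `η` solves the equations that define `𝕀^{d^k} ω` on the cell `U`. For `k = n` there are no
nonzero `(k+1)`-forms, and `η` is the `L²` projection of `ω` to `𝒫₀Λ^n`. -/
def IsAdjProj (k : ℕ) (U : Set (Fin n → ℝ)) (ω η : Form n) : Prop :=
  η ∈ P1m n k ∧ (∀ μ ∈ P1s n (k + 1), pairing k U η μ = pairing k U ω μ) ∧
    (k = n → ∀ c ∈ P0 n n, ip U η c = ip U ω c)

open Classical in
/-- The adjoint projection `𝕀^{d^k} : HΛ^k(U) → 𝒫₁⁻Λ^k` on a cell `U`. -/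
def adjProj (k : ℕ) (U : Set (Fin n → ℝ)) (ω : Form n) : Form n :=
  if h : ∃ η, IsAdjProj k U ω η then h.choose else 0

/-- A cubical mesh of `Ω`: finitely many nondegenerate axis-parallel boxes whose interiors are
pairwise disjoint and lie in `Ω`, and which cover `Ω`. -/
structure CubicalMesh (Ω : Set (Fin n → ℝ)) where
  cells : Finset (BoxIntegral.Box (Fin n))
  interior_subset : ∀ K ∈ cells, cellInterior K ⊆ Ω
  disjoint : (cells : Set (BoxIntegral.Box (Fin n))).PairwiseDisjoint cellInterior
  covers : Ω ⊆ ⋃ K ∈ cells, BoxIntegral.Box.Icc K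

variable {Ω : Set (Fin n → ℝ)}

/-- Families of forms, one on each cell of the mesh. -/
abbrev Broken (G : CubicalMesh Ω) : Type := {K // K ∈ G.cells} → Form n

/-- On every cell, `ω` coincides (almost everywhere) with an element of `S`. -/
def Piecewise (G : CubicalMesh Ω) (S : Submodule ℝ (Form n)) (ω : Form n) : Prop :=
  ∀ K ∈ G.cells, ∃ p ∈ S, ω =ᵐ[volume.restrict (cellInterior K)] p

/-- The conforming space `V^𝒬_h Λ^k`. -/
def VQ (G : CubicalMesh Ω) (k : ℕ) : Set (Form n) := {ω | ω ∈ HL k Ω ∧ Piecewise G (Q1m n k) ω}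

/-- The conforming space `V^𝒬_{h0} Λ^k`. -/
def VQ0 (G : CubicalMesh Ω) (k : ℕ) : Set (Form n) := {ω | ω ∈ HL0 k Ω ∧ Piecewise G (Q1m n k) ω}

/-- The conforming space `V^{𝒬,*}_h Λ^(k+1)`. -/
def VQs (G : CubicalMesh Ω) (k : ℕ) : Set (Form n) :=
  {μ | μ ∈ HsL k Ω ∧ Piecewise G (Q1s n (k + 1)) μ}

/-- The conforming space `V^{𝒬,*}_{h0} Λ^(k+1)`. -/
def VQs0 (G : CubicalMesh Ω) (k : ℕ) : Set (Form n) :=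
  {μ | μ ∈ HsL0 k Ω ∧ Piecewise G (Q1s n (k + 1)) μ}

/-- `W^def_h Λ^k`. -/
def Wdef (G : CubicalMesh Ω) (k : ℕ) : Set (Broken G) :=
  {ω | (∀ K, ω K ∈ P1m n k) ∧ ∀ μ ∈ VQs0 G k, ∑ K, pairing k (cellInterior K.1) (ω K) μ = 0}

/-- `W^def_{h0} Λ^k`. -/
def Wdef0 (G : CubicalMesh Ω) (k : ℕ) : Set (Broken G) :=
  {ω | (∀ K, ω K ∈ P1m n k) ∧ ∀ μ ∈ VQs G k, ∑ K, pairing k (cellInterior K.1) (ω K) μ = 0}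

/-- The global interpolator `𝕀^{d^k}_h`, cell by cell. -/
def interp (G : CubicalMesh Ω) (k : ℕ) (ω : Broken G) : Broken G :=
  fun K => adjProj k (cellInterior K.1) (ω K)

/-- A form on `Ω` as the family of its restrictions to the cells (a form on a cell being
represented by any function that has the right values there). -/
def toBroken (G : CubicalMesh Ω) (ω : Form n) : Broken G := fun _ => ω

end CubicalWhitney

end

open CubicalWhitney

noncomputable section

namespace CubicalWhitney

variable {n : ℕ}

/-! On one cell, let `ω` be in `𝒬₁⁻` and `μ` in `𝒬₁^{*,-}`. The coefficients `ω_σ` and `(dω)_σ`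
depend only on the `x_i` with `i ∉ σ`, while `μ_σ` and `(δμ)_σ` depend only on those with `i ∈ σ`.
By Fubini, integrals of products over the box factor into products of mean values
(`volume_mul_integral_mul`, `volume_mul_pairing`). For such `ω` the pairing therefore sees only the
mean values of `μ` and `δμ`.

Some Whitney-type `μ' ∈ 𝒫₁^{*,-}` has the same mean values as `μ` (`exists_mem_P1s_mean_eq`), and
the interpolant `η` of `ω` is itself of tensor product type because `𝒫₁⁻ ⊂ 𝒬₁⁻`. Hence `b_K(η, μ) =
b_K(η, μ') = b_K(ω, μ') = b_K(ω, μ)` (`IsAdjProj.pairing_eq`): the interpolant keeps its pairing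
with the larger test space.

Summed over the cells this gives the pairing of `ω` and `μ` on `Ω`, which vanishes as soon as one of
the two forms is a limit of test forms (`green_of_mem_HsL0`, `green_of_mem_HL0`).

The interpolant exists and is unique because the pairing with `𝒫₁^{*,-}` amounts to two families of
moments, on which a Whitney form `c + κ e` gives a triangular system: the first family determines
`e`, the second then `c`. For `k = n` the interpolant is the mean value. -/

/-! ### Signs, and the codifferential in coordinates. -/

theorem insSign_mul_self (i : Fin n) (σ : Finset (Fin n)) : insSign i σ * insSign i σ = 1 := by
  simp [insSign, ← mul_pow]

theorem insSign_insert (i : Fin n) (σ : Finset (Fin n)) : insSign i (insert i σ) = insSign i σ := by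
  simp [insSign, Finset.filter_insert]

theorem insSign_erase (i : Fin n) (σ : Finset (Fin n)) : insSign i (σ.erase i) = insSign i σ := by
  have : (σ.erase i).filter (fun j => j < i) = σ.filter (fun j => j < i) := by
    ext j
    simp only [Finset.mem_filter, Finset.mem_erase]
    exact ⟨fun h => ⟨h.1.2, h.2⟩, fun h => ⟨⟨h.2.ne, h.1⟩, h.2⟩⟩
  simp [insSign, this]

theorem compl_erase (i : Fin n) (σ : Finset (Fin n)) : (σ.erase i)ᶜ = insert i σᶜ := by
  ext j; simp

/-- Swapping the two entries turns the inversions counted for `σᶜ` into the non-inversions in `σ ×ˢ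
σᶜ`, so the two counts add up to the size of the whole product. -/
theorem starSign_compl_mul (σ : Finset (Fin n)) :
    starSign σᶜ * starSign σ = (-1) ^ (σ.card * σᶜ.card) := by
  unfold starSign
  rw [← pow_add, ← Finset.card_product σ σᶜ,
    ← Finset.card_filter_add_card_filter_not (s := σ ×ˢ σᶜ) (fun p => p.2 < p.1), add_comm, compl_compl]
  congr 2
  refine Finset.card_bij (fun p _ => (p.2, p.1)) ?_ ?_ ?_
  · rintro ⟨a, b⟩ h
    simp only [Finset.mem_filter, Finset.mem_product] at h ⊢
    exact ⟨⟨h.1.2, h.1.1⟩, not_lt.2 h.2.le⟩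
  · rintro ⟨a, b⟩ _ ⟨c, d⟩ _ h
    simp_all
  · rintro ⟨a, b⟩ h
    simp only [Finset.mem_filter, Finset.mem_product, not_lt] at h
    refine ⟨(b, a), ?_, rfl⟩
    simp only [Finset.mem_filter, Finset.mem_product]
    refine ⟨⟨h.1.2, h.1.1⟩, lt_of_le_of_ne h.2 ?_⟩
    rintro rfl
    exact (Finset.mem_compl.1 h.1.2) h.1.1

theorem starSign_eq_prod (σ : Finset (Fin n)) :
    starSign σ = ∏ a ∈ σ, ∏ b ∈ σᶜ, if b < a then (-1 : ℝ) else 1 := by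
  rw [← Finset.prod_product', Finset.prod_ite]
  simp [starSign]

theorem insSign_eq_prod (i : Fin n) (σ : Finset (Fin n)) :
    insSign i σ = ∏ b ∈ σ, if b < i then (-1 : ℝ) else 1 := by
  rw [Finset.prod_ite]
  simp [insSign]

/-- Moving `i` into `σ` removes the inversions `(a, i)` with `i < a ∈ σ` and creates the `(i, b)`
with `b < i`, `b ∉ σ`; all others are common to both sides. -/
theorem starSign_insert {i : Fin n} {σ : Finset (Fin n)} (hi : i ∉ σ) :
    starSign (insert i σ) = starSign σ * (-1) ^ σ.card * insSign i σ * insSign i σᶜ := by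
  have hc : σᶜ = insert i (insert i σ)ᶜ := by
    ext j
    by_cases h : j = i <;> simp [h, hi]
  have hn : i ∉ (insert i σ)ᶜ := by simp
  have h1 : starSign σ = (∏ a ∈ σ, if i < a then (-1 : ℝ) else 1) *
      ∏ a ∈ σ, ∏ b ∈ (insert i σ)ᶜ, if b < a then (-1 : ℝ) else 1 := by
    rw [starSign_eq_prod, ← Finset.prod_mul_distrib]
    refine Finset.prod_congr rfl fun a _ => ?_
    rw [hc, Finset.prod_insert hn]
  have h2 : (∏ a ∈ σ, if i < a then (-1 : ℝ) else 1) = (-1) ^ σ.card * insSign i σ := by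
    rw [insSign_eq_prod, ← Finset.prod_const, ← Finset.prod_mul_distrib]
    refine Finset.prod_congr rfl fun a ha => ?_
    have hne : a ≠ i := fun h => hi (h ▸ ha)
    rcases lt_or_gt_of_ne hne with h | h
    · simp [h, h.not_gt]
    · simp [h, h.not_gt]
  have h3 : insSign i σᶜ = ∏ b ∈ (insert i σ)ᶜ, if b < i then (-1 : ℝ) else 1 := by
    rw [hc, insSign_insert, insSign_eq_prod]
  rw [starSign_eq_prod, Finset.prod_insert hi, h1, h2, h3]
  set P := ∏ a ∈ σ, ∏ b ∈ (insert i σ)ᶜ, if b < a then (-1 : ℝ) else 1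
  set Q := ∏ b ∈ (insert i σ)ᶜ, if b < i then (-1 : ℝ) else 1
  have e1 := insSign_mul_self i σ
  have e2 : ((-1 : ℝ) ^ σ.card) * (-1) ^ σ.card = 1 := by simp [← mul_pow]
  linear_combination (-P * Q) * e1 - P * Q * insSign i σ * insSign i σ * e2

theorem hodge_hodge (ω : Form n) (x : Fin n → ℝ) (σ : Finset (Fin n)) :
    hodge (hodge ω) x σ = (-1) ^ (σ.card * σᶜ.card) * ω x σ := by
  simp only [hodge, LinearMap.coe_mk, AddHom.coe_mk, compl_compl]
  rw [← mul_assoc, starSign_compl_mul]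

/-- The sign in `codiff` cancels those of the two Hodge stars, so that `δ` becomes minus the plain
transpose of the formula for `extd`. -/
theorem codiff_apply {k : ℕ} (ω : Form n) (x : Fin n → ℝ) {σ : Finset (Fin n)} (hσ : σ.card = k)
    (hd : ∀ τ, DifferentiableAt ℝ (fun y => ω y τ) x) :
    codiff (k + 1) ω x σ =
      -∑ i ∈ σᶜ, insSign i σ * fderiv ℝ (fun y => ω y (insert i σ)) x (Pi.single i 1) := by
  simp only [codiff, hodge, extd, LinearMap.coe_mk, AddHom.coe_mk, Pi.smul_apply, smul_eq_mul]
  rw [Finset.mul_sum, Finset.mul_sum, ← Finset.sum_neg_distrib]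
  refine Finset.sum_congr rfl fun i hi => ?_
  have hi' : i ∉ σ := Finset.mem_compl.1 hi
  rw [compl_erase, compl_compl, fderiv_const_mul (hd _)]
  simp only [FunLike.coe_smul, Pi.smul_apply, smul_eq_mul]
  rw [starSign_insert hi']
  have e1 := starSign_compl_mul σ
  have e2 := insSign_mul_self i σᶜ
  have hc : σᶜ.card + k = n := by
    rw [← hσ, add_comm, Finset.card_add_card_compl, Fintype.card_fin]
  have e3 : (-1 : ℝ) ^ (n * (k + 1 + 1) + 1) * (-1) ^ (σ.card * σᶜ.card) * (-1) ^ σ.card = -1 := by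
    rw [← pow_add, ← pow_add, hσ]
    refine Odd.neg_one_pow ?_
    generalize σᶜ.card = c at hc
    subst hc
    -- With `n = c + k`, the total exponent is an even number plus `k(k+1)` plus 1, hence odd.
    rw [show (c + k) * (k + 1 + 1) + 1 + k * c + k = 2 * (c * k + c + k) + k * (k + 1) + 1 by ring]
    exact ((even_two_mul _).add (Nat.even_mul_succ_self k)).add_one
  set D := fderiv ℝ (fun y => ω y (insert i σ)) x (Pi.single i 1)
  calc _ = ((-1 : ℝ) ^ (n * (k + 1 + 1) + 1) * (starSign σᶜ * starSign σ) * (-1) ^ σ.card) *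
        (insSign i σᶜ * insSign i σᶜ) * insSign i σ * D := by ring
    _ = _ := by rw [e1, e2, e3]; ring

theorem IsDeg.hodge {k m : ℕ} (h : k + m = n) {ω : Form n} (hω : IsDeg k ω) :
    IsDeg m (CubicalWhitney.hodge ω) := fun x σ hσ => by
  have : σᶜ.card ≠ k := by
    have := Finset.card_add_card_compl σ
    rw [Fintype.card_fin] at this
    omega
  simp [CubicalWhitney.hodge, hω x _ this]

theorem IsDeg.extd {k : ℕ} {ω : Form n} (hω : IsDeg k ω) : IsDeg (k + 1) (extd ω) :=
  fun x ρ hρ => Finset.sum_eq_zero fun i hi => by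
    have : (fun y => ω y (ρ.erase i)) = fun _ => 0 := funext fun y => hω y _ fun h => hρ (by
      rw [← h, Finset.card_erase_add_one hi])
    simp [this]

theorem IsDeg.codiff {k : ℕ} {ω : Form n} (hω : IsDeg (k + 1) ω) : IsDeg k (codiff (k + 1) ω) :=
  fun x ρ hρ => by
    simp only [CubicalWhitney.codiff, CubicalWhitney.hodge, CubicalWhitney.extd, LinearMap.coe_mk,
      AddHom.coe_mk, Pi.smul_apply, smul_eq_mul]
    rw [Finset.sum_eq_zero, mul_zero, mul_zero]
    intro i hi
    have : (fun y => starSign (ρᶜ.erase i)ᶜ * ω y (ρᶜ.erase i)ᶜ) = fun _ => 0 := funext fun y => by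
      rw [hω y _ fun h => hρ ?_, mul_zero]
      rw [compl_erase, compl_compl, Finset.card_insert_of_notMem (Finset.mem_compl.1 hi)] at h
      omega
    rw [this]
    simp

/-! ### Exterior multiplication by the position covector, the transpose of `κ`. -/

/-- Exterior multiplication by `∑ i, x_i dx^i`. -/
def wedgeX (b : Form n) : Form n := fun x β => ∑ i ∈ β, insSign i β * x i * b x (β.erase i)

theorem hodge_koszul {k : ℕ} (hk : k + 1 ≤ n) {e : Form n} (he : IsDeg (n - k) e) :
    hodge (koszul e) = (-1 : ℝ) ^ (n - k - 1) • wedgeX (hodge e) := by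
  funext x β
  simp only [hodge, koszul, wedgeX, LinearMap.coe_mk, AddHom.coe_mk, Pi.smul_apply, smul_eq_mul,
    compl_compl, Finset.mul_sum]
  refine Finset.sum_congr rfl fun i hi => ?_
  rw [compl_erase]
  have hi' : i ∉ βᶜ := by simpa using hi
  have hcb := Finset.card_add_card_compl β
  rw [Fintype.card_fin] at hcb
  by_cases hβ : βᶜ.card = n - k - 1
  · rw [starSign_insert hi', compl_compl, hβ]
    have e1 := insSign_mul_self i β
    have e2 : ((-1 : ℝ) ^ (n - k - 1)) * (-1) ^ (n - k - 1) = 1 := by simp [← mul_pow]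
    set s := (-1 : ℝ) ^ (n - k - 1)
    calc _ = starSign βᶜ * (insSign i βᶜ * x i * e x (insert i βᶜ)) * 1 * 1 := by ring
      _ = starSign βᶜ * (insSign i βᶜ * x i * e x (insert i βᶜ)) * (s * s) *
          (insSign i β * insSign i β) := by rw [e1, e2]
      _ = _ := by ring
  · rw [he x (insert i βᶜ)]
    · simp
    · rw [Finset.card_insert_of_notMem hi']
      omega

/-- Both sides run over the same incidences: pairs `i ∈ β` correspond to pairs `i ∉ α` through `α =
β \ {i}`. -/
theorem sum_mul_wedgeX (f : Cov n) (b : Form n) (x : Fin n → ℝ) :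
    ∑ β, f β * wedgeX b x β = ∑ α, koszul (fun _ => f) x α * b x α := by
  simp only [wedgeX, koszul, LinearMap.coe_mk, AddHom.coe_mk, Finset.mul_sum, Finset.sum_mul]
  rw [Finset.sum_sigma', Finset.sum_sigma']
  refine Finset.sum_bij' (fun p _ => ⟨p.1.erase p.2, p.2⟩) (fun p _ => ⟨insert p.2 p.1, p.2⟩)
    ?_ ?_ ?_ ?_ ?_
  · rintro ⟨β, i⟩ h; simp
  · rintro ⟨β, i⟩ h; simp
  · rintro ⟨β, i⟩ h
    simp only [Finset.mem_sigma, Finset.mem_univ, true_and] at h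
    simp [Finset.insert_erase h]
  · rintro ⟨β, i⟩ h
    simp only [Finset.mem_sigma, Finset.mem_univ, true_and, Finset.mem_compl] at h
    simp [Finset.erase_insert h]
  · rintro ⟨β, i⟩ h
    simp only [Finset.mem_sigma, Finset.mem_univ, true_and] at h
    simp only [insSign_erase, Finset.insert_erase h]
    ring

/-- `D i τ` stands for `∂ᵢ ω_τ`; the reindexing prepares the integration by parts in `ip_extd`. -/
theorem sum_extd_mul (D : Fin n → Finset (Fin n) → ℝ) (g : Cov n) :
    ∑ ρ, (∑ i ∈ ρ, insSign i ρ * D i (ρ.erase i)) * g ρ =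
      ∑ α, ∑ i ∈ αᶜ, insSign i α * D i α * g (insert i α) := by
  simp only [Finset.sum_mul]
  rw [Finset.sum_sigma', Finset.sum_sigma']
  refine Finset.sum_bij' (fun p _ => ⟨p.1.erase p.2, p.2⟩) (fun p _ => ⟨insert p.2 p.1, p.2⟩)
    ?_ ?_ ?_ ?_ ?_
  · rintro ⟨β, i⟩ h; simp
  · rintro ⟨β, i⟩ h; simp
  · rintro ⟨β, i⟩ h
    simp only [Finset.mem_sigma, Finset.mem_univ, true_and] at h
    simp [Finset.insert_erase h]
  · rintro ⟨β, i⟩ h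
    simp only [Finset.mem_sigma, Finset.mem_univ, true_and, Finset.mem_compl] at h
    simp [Finset.erase_insert h]
  · rintro ⟨β, i⟩ h
    simp only [Finset.mem_sigma, Finset.mem_univ, true_and] at h
    simp only [insSign_erase, Finset.insert_erase h]


/-! ### Smooth forms and integration by parts. -/

/-- All coefficients of `ω` are smooth. -/
def SmoothForm (ω : Form n) : Prop := ∀ σ, ContDiff ℝ (⊤ : ℕ∞) fun x => ω x σ

theorem SmoothForm.differentiable {ω : Form n} (h : SmoothForm ω) (σ : Finset (Fin n)) :
    Differentiable ℝ fun x => ω x σ := (h σ).differentiable (by simp)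

theorem IsTest.smoothForm {k : ℕ} {U : Set (Fin n → ℝ)} {φ : Form n} (h : IsTest k U φ) :
    SmoothForm φ := fun σ => contDiff_pi.1 h.2.1 σ

theorem contDiff_partial {f : (Fin n → ℝ) → ℝ} (hf : ContDiff ℝ (⊤ : ℕ∞) f) (v : Fin n → ℝ) :
    ContDiff ℝ (⊤ : ℕ∞) fun x => fderiv ℝ f x v :=
  (hf.fderiv_right (m := (⊤ : ℕ∞)) (by simp)).clm_apply contDiff_const

theorem SmoothForm.extd {ω : Form n} (h : SmoothForm ω) : SmoothForm (extd ω) := fun ρ => by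
  unfold CubicalWhitney.extd
  exact ContDiff.sum fun i _ => contDiff_const.mul (contDiff_partial (h _) _)

theorem SmoothForm.hodge {ω : Form n} (h : SmoothForm ω) : SmoothForm (hodge ω) := fun ρ =>
  contDiff_const.mul (h ρᶜ)

theorem SmoothForm.codiff {ω : Form n} (h : SmoothForm ω) (m : ℕ) : SmoothForm (codiff m ω) :=
  fun ρ => contDiff_const.mul (h.hodge.extd.hodge ρ)

theorem extd_eq_zero_of_notMem_tsupport {ω : Form n} {x : Fin n → ℝ} (hx : x ∉ tsupport ω) :
    extd ω x = 0 := by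
  funext ρ
  refine Finset.sum_eq_zero fun i _ => ?_
  have : (fun y => ω y (ρ.erase i)) =ᶠ[nhds x] fun _ => 0 := by
    filter_upwards [notMem_tsupport_iff_eventuallyEq.1 hx] with y hy
    simp [hy]
  simp [this.fderiv_eq]

theorem codiff_eq_zero_of_notMem_tsupport {ω : Form n} {x : Fin n → ℝ} (m : ℕ)
    (hx : x ∉ tsupport ω) : codiff m ω x = 0 := by
  funext ρ
  have : x ∉ tsupport (hodge ω) := by
    rw [notMem_tsupport_iff_eventuallyEq] at hx ⊢
    filter_upwards [hx] with y hy
    funext σ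
    simp [hodge, hy]
  change _ * (starSign ρᶜ * extd (hodge ω) x ρᶜ) = 0
  simp [extd_eq_zero_of_notMem_tsupport this]

theorem integral_partial_mul {f g : (Fin n → ℝ) → ℝ} (hf : ContDiff ℝ (⊤ : ℕ∞) f)
    (hg : ContDiff ℝ (⊤ : ℕ∞) g) (hc : HasCompactSupport f ∨ HasCompactSupport g)
    (v : Fin n → ℝ) :
    Integrable (fun x => fderiv ℝ f x v * g x) ∧ Integrable (fun x => f x * fderiv ℝ g x v) ∧
      ∫ x, fderiv ℝ f x v * g x = -∫ x, f x * fderiv ℝ g x v := by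
  have cf := (contDiff_partial hf v).continuous
  have cg := (contDiff_partial hg v).continuous
  have h1 : Integrable fun x => fderiv ℝ f x v * g x := by
    refine (cf.mul hg.continuous).integrable_of_hasCompactSupport ?_
    rcases hc with hc | hc
    · exact (hc.fderiv_apply (𝕜 := ℝ) v).mul_right
    · exact hc.mul_left
  have h2 : Integrable fun x => f x * fderiv ℝ g x v := by
    refine (hf.continuous.mul cg).integrable_of_hasCompactSupport ?_
    rcases hc with hc | hc
    · exact hc.mul_right
    · exact (hc.fderiv_apply (𝕜 := ℝ) v).mul_left
  have h3 : Integrable fun x => f x * g x := by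
    refine (hf.continuous.mul hg.continuous).integrable_of_hasCompactSupport ?_
    rcases hc with hc | hc
    · exact hc.mul_right
    · exact hc.mul_left
  refine ⟨h1, h2, ?_⟩
  rw [integral_mul_fderiv_eq_neg_fderiv_mul_of_integrable h1 h2 h3
    (fun x _ => hf.differentiable (by simp) x) (fun x _ => hg.differentiable (by simp) x), neg_neg]

theorem hasCompactSupport_coeff {ω : Form n} (h : HasCompactSupport ω) (σ : Finset (Fin n)) :
    HasCompactSupport fun x => ω x σ :=
  h.comp_left (g := fun v : Cov n => v σ) rfl

/-- `d` on `k`-forms and `δ` on `(k+1)`-forms are formally adjoint. -/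
theorem ip_extd {k : ℕ} {U : Set (Fin n → ℝ)} {ω φ : Form n} (hd : IsDeg k ω)
    (hω : SmoothForm ω) (hφ : SmoothForm φ)
    (hc : (HasCompactSupport ω ∧ tsupport ω ⊆ U) ∨ (HasCompactSupport φ ∧ tsupport φ ⊆ U)) :
    ip U (extd ω) φ = ip U ω (codiff (k + 1) φ) := by
  have key := fun (α : Finset (Fin n)) (i : Fin n) =>
    integral_partial_mul (hω α) (hφ (insert i α))
      (hc.imp (fun h => hasCompactSupport_coeff h.1 _) (fun h => hasCompactSupport_coeff h.1 _))
      (Pi.single i 1)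
  unfold ip
  -- One of the two forms is supported in `U`, so both integrals extend to the whole space.
  rw [setIntegral_eq_integral_of_forall_compl_eq_zero,
    setIntegral_eq_integral_of_forall_compl_eq_zero]
  · have e1 : ∀ x, ∑ ρ, extd ω x ρ * φ x ρ = ∑ α, ∑ i ∈ αᶜ, insSign i α *
        (fderiv ℝ (fun y => ω y α) x (Pi.single i 1) * φ x (insert i α)) := fun x => by
      simp_rw [← mul_assoc]
      exact sum_extd_mul (fun i τ => fderiv ℝ (fun y => ω y τ) x (Pi.single i 1)) (φ x)
    have e2 : ∀ x, ∑ α, ω x α * codiff (k + 1) φ x α = ∑ α, ∑ i ∈ αᶜ, insSign i α *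
        (-(ω x α * fderiv ℝ (fun y => φ y (insert i α)) x (Pi.single i 1))) := fun x => by
      refine Finset.sum_congr rfl fun α _ => ?_
      by_cases hα : α.card = k
      · rw [codiff_apply φ x hα fun τ => hφ.differentiable τ x, ← Finset.sum_neg_distrib,
          Finset.mul_sum]
        refine Finset.sum_congr rfl fun i _ => by ring
      · simp [hd x α hα]
    simp_rw [e1, e2]
    rw [integral_finsetSum, integral_finsetSum]
    · refine Finset.sum_congr rfl fun α _ => ?_
      rw [integral_finsetSum, integral_finsetSum]
      · refine Finset.sum_congr rfl fun i _ => ?_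
        rw [integral_const_mul, integral_const_mul, (key α i).2.2, integral_neg]
      · exact fun i _ => (key α i).2.1.neg.const_mul _
      · exact fun i _ => (key α i).1.const_mul _
    · exact fun α _ => integrable_finsetSum _ fun i _ => (key α i).2.1.neg.const_mul _
    · exact fun α _ => integrable_finsetSum _ fun i _ => (key α i).1.const_mul _
  · intro x hx
    rcases hc with hc | hc
    · simp [image_eq_zero_of_notMem_tsupport fun h => hx (hc.2 h)]
    · simp [codiff_eq_zero_of_notMem_tsupport (k + 1) fun h => hx (hc.2 h)]
  · intro x hx
    rcases hc with hc | hc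
    · simp [extd_eq_zero_of_notMem_tsupport fun h => hx (hc.2 h)]
    · simp [image_eq_zero_of_notMem_tsupport fun h => hx (hc.2 h)]

/-! ### The `L²` product; restriction and uniqueness of weak derivatives. -/

theorem ip_comm (U : Set (Fin n → ℝ)) (ω η : Form n) : ip U ω η = ip U η ω := by
  simp only [ip, mul_comm]

theorem ip_congr {U : Set (Fin n → ℝ)} {ω ω' η η' : Form n}
    (h : ω =ᵐ[volume.restrict U] ω') (h' : η =ᵐ[volume.restrict U] η') :
    ip U ω η = ip U ω' η' :=
  integral_congr_ae (by filter_upwards [h, h'] with x hx hx'; rw [hx, hx'])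

theorem MemL2.integrable {k m : ℕ} {U : Set (Fin n → ℝ)} {ω η : Form n} (h : MemL2 k U ω)
    (h' : MemL2 m U η) : Integrable (fun x => ∑ σ, ω x σ * η x σ) (volume.restrict U) :=
  integrable_finsetSum _ fun σ _ => (h.2 σ).integrable_mul (h'.2 σ)

theorem MemL2.sub {k : ℕ} {U : Set (Fin n → ℝ)} {ω η : Form n} (h : MemL2 k U ω)
    (h' : MemL2 k U η) : MemL2 k U (ω - η) :=
  ⟨fun x σ hσ => by simp [h.1 x σ hσ, h'.1 x σ hσ], fun σ => (h.2 σ).sub (h'.2 σ)⟩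

theorem ip_sub_left {k l m : ℕ} {U : Set (Fin n → ℝ)} {ω η φ : Form n} (h : MemL2 k U ω)
    (h' : MemL2 l U η) (h'' : MemL2 m U φ) : ip U (ω - η) φ = ip U ω φ - ip U η φ := by
  unfold ip
  rw [← integral_sub (h.integrable h'') (h'.integrable h'')]
  simp [sub_mul]

theorem ip_sub_right {k l m : ℕ} {U : Set (Fin n → ℝ)} {ω η φ : Form n} (h : MemL2 k U ω)
    (h' : MemL2 l U η) (h'' : MemL2 m U φ) : ip U ω (η - φ) = ip U ω η - ip U ω φ := by
  rw [ip_comm, ip_sub_left h' h'' h, ip_comm, ip_comm U φ]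

theorem MemL2.of_compactSupport {k : ℕ} {U : Set (Fin n → ℝ)} {ω : Form n} (hd : IsDeg k ω)
    (hs : SmoothForm ω) {C : Set (Fin n → ℝ)} (hC : IsCompact C) (h : ∀ x ∉ C, ω x = 0) :
    MemL2 k U ω :=
  ⟨hd, fun σ => ((hs σ).continuous.memLp_of_hasCompactSupport
    (HasCompactSupport.intro hC fun x hx => by simp [h x hx])).restrict U⟩

theorem IsTest.memL2 {k : ℕ} {U : Set (Fin n → ℝ)} {φ : Form n} (h : IsTest k U φ) :
    MemL2 k U φ :=
  .of_compactSupport h.1 h.smoothForm h.2.2.1 fun _ hx => image_eq_zero_of_notMem_tsupport hx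

theorem IsTest.memL2_extd {k : ℕ} {U : Set (Fin n → ℝ)} {φ : Form n} (h : IsTest k U φ) :
    MemL2 (k + 1) U (extd φ) :=
  .of_compactSupport h.1.extd h.smoothForm.extd h.2.2.1 fun _ hx =>
    extd_eq_zero_of_notMem_tsupport hx

theorem IsTest.memL2_codiff {k : ℕ} {U : Set (Fin n → ℝ)} {φ : Form n} (h : IsTest (k + 1) U φ) :
    MemL2 k U (codiff (k + 1) φ) :=
  .of_compactSupport h.1.codiff (h.smoothForm.codiff _) h.2.2.1 fun _ hx =>
    codiff_eq_zero_of_notMem_tsupport _ hx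

theorem IsTest.mono {k : ℕ} {U V : Set (Fin n → ℝ)} (hUV : U ⊆ V) {φ : Form n}
    (h : IsTest k U φ) : IsTest k V φ := ⟨h.1, h.2.1, h.2.2.1, h.2.2.2.trans hUV⟩

theorem MemL2.mono {k : ℕ} {U V : Set (Fin n → ℝ)} (hUV : U ⊆ V) {φ : Form n}
    (h : MemL2 k V φ) : MemL2 k U φ :=
  ⟨h.1, fun σ => (h.2 σ).mono_measure (Measure.restrict_mono hUV le_rfl)⟩

theorem ip_eq_of_subset {U V : Set (Fin n → ℝ)} (hUV : U ⊆ V) (hV : MeasurableSet V)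
    {ω φ : Form n} (h : ∀ x ∉ U, φ x = 0) : ip V ω φ = ip U ω φ := by
  unfold ip
  refine setIntegral_eq_of_subset_of_forall_sdiff_eq_zero hV hUV fun x hx => ?_
  simp [h x hx.2]

theorem IsWeakD.mono {k : ℕ} {U V : Set (Fin n → ℝ)} (hUV : U ⊆ V) (hV : MeasurableSet V)
    {ω η : Form n} (h : IsWeakD k V ω η) : IsWeakD k U ω η :=
  ⟨h.1.mono hUV, fun φ hφ => by
    have := h.2 φ (hφ.mono hUV)
    rwa [ip_eq_of_subset hUV hV fun x hx => image_eq_zero_of_notMem_tsupport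
        fun h => hx (hφ.2.2.2 h),
      ip_eq_of_subset hUV hV fun x hx => codiff_eq_zero_of_notMem_tsupport _
        fun h => hx (hφ.2.2.2 h)] at this⟩

theorem IsWeakCod.mono {k : ℕ} {U V : Set (Fin n → ℝ)} (hUV : U ⊆ V) (hV : MeasurableSet V)
    {ω η : Form n} (h : IsWeakCod k V ω η) : IsWeakCod k U ω η :=
  ⟨h.1.mono hUV, fun φ hφ => by
    have := h.2 φ (hφ.mono hUV)
    rwa [ip_eq_of_subset hUV hV fun x hx => image_eq_zero_of_notMem_tsupport
        fun h => hx (hφ.2.2.2 h),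
      ip_eq_of_subset hUV hV fun x hx => extd_eq_zero_of_notMem_tsupport
        fun h => hx (hφ.2.2.2 h)] at this⟩

theorem IsWeakD.congr {k : ℕ} {U : Set (Fin n → ℝ)} {ω ω' η : Form n}
    (h : IsWeakD k U ω η) (hω : ω =ᵐ[volume.restrict U] ω') : IsWeakD k U ω' η :=
  ⟨h.1, fun φ hφ => (h.2 φ hφ).trans (ip_congr hω (ae_eq_refl _))⟩

theorem IsWeakCod.congr {k : ℕ} {U : Set (Fin n → ℝ)} {ω ω' η : Form n}
    (h : IsWeakCod k U ω η) (hω : ω =ᵐ[volume.restrict U] ω') : IsWeakCod k U ω' η :=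
  ⟨h.1, fun φ hφ => (h.2 φ hφ).trans (ip_congr hω (ae_eq_refl _))⟩

/-- The fundamental lemma of the calculus of variations. -/
theorem MemL2.ae_eq_zero {k : ℕ} {U : Set (Fin n → ℝ)} (hU : IsOpen U) {η : Form n}
    (h : MemL2 k U η) (h0 : ∀ φ, IsTest k U φ → ip U η φ = 0) :
    η =ᵐ[volume.restrict U] 0 := by
  have : ∀ σ, ∀ᵐ x ∂volume.restrict U, η x σ = 0 := fun σ => by
    by_cases hσ : σ.card = k
    · have := hU.ae_eq_zero_of_integral_contDiff_smul_eq_zero (μ := volume.restrict U)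
        (f := fun x => η x σ) (((h.2 σ).locallyIntegrable (by norm_num)).locallyIntegrableOn U) ?_
      · filter_upwards [this, ae_restrict_mem hU.measurableSet] with x hx hx' using hx hx'
      · intro g hg hc hs
        have hz : ∀ x, x ∉ tsupport g → (Pi.single σ (g x) : Cov n) = 0 := fun x hx => by
          simp [image_eq_zero_of_notMem_tsupport hx]
        have ht : IsTest k U fun x => Pi.single σ (g x) := by
          have hsub : tsupport (fun x => (Pi.single σ (g x) : Cov n)) ⊆ tsupport g :=
            closure_minimal (fun x hx => by_contra fun hx' => hx (hz x hx')) (isClosed_tsupport g)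
          refine ⟨fun x τ hτ => ?_, ?_, hc.of_isClosed_subset (isClosed_tsupport _) hsub,
            hsub.trans hs⟩
          · have hne : τ ≠ σ := fun h => hτ (h ▸ hσ)
            simp [Pi.single_eq_of_ne hne]
          · refine contDiff_pi.2 fun τ => ?_
            by_cases hτ : τ = σ
            · subst hτ; simpa using hg
            · simpa [Pi.single_eq_of_ne hτ] using contDiff_const
        have := h0 _ ht
        unfold ip at this
        rw [← this]
        refine integral_congr_ae (.of_forall fun x => ?_)
        simp only [smul_eq_mul]
        rw [Finset.sum_eq_single σ]
        · simp [mul_comm]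
        · intro τ _ hτ
          simp [Pi.single_eq_of_ne hτ]
        · simp
    · exact .of_forall fun x => h.1 x σ hσ
  filter_upwards [ae_all_iff.2 this] with x hx
  funext σ
  exact hx σ

theorem IsWeakD.unique {k : ℕ} {U : Set (Fin n → ℝ)} (hU : IsOpen U) {ω η η' : Form n}
    (h : IsWeakD k U ω η) (h' : IsWeakD k U ω η') : η =ᵐ[volume.restrict U] η' := by
  have := (h.1.sub h'.1).ae_eq_zero hU fun φ hφ => by
    rw [ip_sub_left h.1 h'.1 hφ.memL2, h.2 φ hφ, h'.2 φ hφ, sub_self]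
  filter_upwards [this] with x hx using sub_eq_zero.1 hx

theorem IsWeakCod.unique {k : ℕ} {U : Set (Fin n → ℝ)} (hU : IsOpen U) {ω η η' : Form n}
    (h : IsWeakCod k U ω η) (h' : IsWeakCod k U ω η') : η =ᵐ[volume.restrict U] η' := by
  have := (h.1.sub h'.1).ae_eq_zero hU fun φ hφ => by
    rw [ip_sub_left h.1 h'.1 hφ.memL2, h.2 φ hφ, h'.2 φ hφ, sub_self]
  filter_upwards [this] with x hx using sub_eq_zero.1 hx

theorem isWeakD_wd {k : ℕ} {U : Set (Fin n → ℝ)} {ω η : Form n} (h : IsWeakD k U ω η) :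
    IsWeakD k U ω (wd k U ω) := by
  have h' : ∃ η, IsWeakD k U ω η := ⟨η, h⟩
  rw [wd, dif_pos h']
  exact h'.choose_spec

theorem isWeakCod_wcod {k : ℕ} {U : Set (Fin n → ℝ)} {ω η : Form n} (h : IsWeakCod k U ω η) :
    IsWeakCod k U ω (wcod k U ω) := by
  have h' : ∃ η, IsWeakCod k U ω η := ⟨η, h⟩
  rw [wcod, dif_pos h']
  exact h'.choose_spec

/-- `wd` is a choice among almost everywhere equal representatives; this replaces it by any
convenient one. -/
theorem IsWeakD.wd_ae_eq {k : ℕ} {U : Set (Fin n → ℝ)} (hU : IsOpen U) {ω η : Form n}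
    (h : IsWeakD k U ω η) : wd k U ω =ᵐ[volume.restrict U] η := (isWeakD_wd h).unique hU h

theorem IsWeakCod.wcod_ae_eq {k : ℕ} {U : Set (Fin n → ℝ)} (hU : IsOpen U) {ω η : Form n}
    (h : IsWeakCod k U ω η) : wcod k U ω =ᵐ[volume.restrict U] η := (isWeakCod_wcod h).unique hU h


/-! ### Multiaffine functions and factorization of integrals over a box. -/

section

/-- Smooth functions of the variables in `S` that are affine in every single variable. -/
def multiaffine (S : Finset (Fin n)) : Submodule ℝ ((Fin n → ℝ) → ℝ) where
  carrier := {f | ContDiff ℝ (⊤ : ℕ∞) f ∧ DependsOn f (S : Set (Fin n)) ∧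
    ∀ x i t, f (Function.update x i t) = f (Function.update x i 0) +
      t * (f (Function.update x i 1) - f (Function.update x i 0))}
  add_mem' := by
    rintro f g ⟨hf, hf', hf''⟩ ⟨hg, hg', hg''⟩
    refine ⟨hf.add hg, fun x y h => congrArg₂ (· + ·) (hf' h) (hg' h), fun x i t => ?_⟩
    simp only [Pi.add_apply]
    rw [hf'', hg'']
    ring
  zero_mem' := ⟨contDiff_const, fun _ _ _ => rfl, fun _ _ _ => by simp⟩
  smul_mem' := by
    rintro c f ⟨hf, hf', hf''⟩
    refine ⟨contDiff_const.smul hf, fun x y h => congrArg (c • ·) (hf' h), fun x i t => ?_⟩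
    simp only [Pi.smul_apply, smul_eq_mul]
    rw [hf'']
    ring

theorem const_mem_multiaffine (S : Finset (Fin n)) (c : ℝ) : (fun _ => c) ∈ multiaffine S :=
  ⟨contDiff_const, fun _ _ _ => rfl, fun _ _ _ => by simp⟩

theorem coord_mem_multiaffine {S : Finset (Fin n)} {i : Fin n} (hi : i ∈ S) :
    (fun x : Fin n → ℝ => x i) ∈ multiaffine S := by
  refine ⟨contDiff_apply ℝ ℝ i, fun x y h => h i hi, fun x j t => ?_⟩
  by_cases h : i = j
  · subst h; simp
  · simp [Function.update_of_ne h]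

theorem prod_mem_multiaffine {S : Finset (Fin n)} {p : Fin n → Polynomial ℝ}
    (hp : ∀ i, (p i).natDegree ≤ if i ∈ S then 1 else 0) :
    (fun x : Fin n → ℝ => ∏ i, (p i).eval (x i)) ∈ multiaffine S := by
  refine ⟨?_, fun x y h => ?_, fun x i t => ?_⟩
  · refine contDiff_prod fun i _ => ?_
    exact ((p i).contDiff_aeval (𝕜 := ℝ) _).comp (contDiff_apply ℝ ℝ i)
  · refine Finset.prod_congr rfl fun i _ => ?_
    by_cases hi : i ∈ S
    · rw [h i hi]
    · have := hp i
      rw [if_neg hi, Nat.le_zero] at this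
      rw [Polynomial.eq_C_of_natDegree_eq_zero this, Polynomial.eval_C, Polynomial.eval_C]
  · have h1 : (p i).natDegree ≤ 1 := (hp i).trans (by split_ifs <;> simp)
    have key : ∀ s, ∏ j, (p j).eval (Function.update x i s j) =
        (p i).eval s * ∏ j ∈ Finset.univ.erase i, (p j).eval (x j) := fun s => by
      rw [← Finset.mul_prod_erase _ _ (Finset.mem_univ i), Function.update_self]
      congr 1
      refine Finset.prod_congr rfl fun j hj => ?_
      rw [Function.update_of_ne (Finset.ne_of_mem_erase hj)]
    simp only [key]
    rw [Polynomial.eq_X_add_C_of_natDegree_le_one h1]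
    simp
    ring

theorem partial_of_mem_multiaffine {S : Finset (Fin n)} {f : (Fin n → ℝ) → ℝ}
    (hf : f ∈ multiaffine S) (x : Fin n → ℝ) (i : Fin n) :
    fderiv ℝ f x (Pi.single i 1) = f (Function.update x i 1) - f (Function.update x i 0) := by
  have h1 : HasDerivAt (fun t : ℝ => f (x + t • Pi.single i 1)) (fderiv ℝ f x (Pi.single i 1)) 0 :=
    ((hf.1.differentiable (by simp)) x).hasFDerivAt.hasLineDerivAt _
  refine h1.unique ?_
  have h2 : (fun t : ℝ => f (x + t • Pi.single i 1)) = fun t => f (Function.update x i 0) +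
      (x i + t) * (f (Function.update x i 1) - f (Function.update x i 0)) := by
    funext t
    rw [← hf.2.2 x i (x i + t)]
    congr 1
    funext j
    by_cases h : j = i
    · subst h; simp
    · simp [h]
  rw [h2]
  simpa using (((hasDerivAt_id (0 : ℝ)).const_add (x i)).mul_const
    (f (Function.update x i 1) - f (Function.update x i 0))).const_add (f (Function.update x i 0))

/-- An affine function of `x_i` has a slope independent of `x_i`, so differentiation removes `i`
from the set of variables. -/
theorem dependsOn_partial {S : Finset (Fin n)} {f : (Fin n → ℝ) → ℝ}
    (hf : f ∈ multiaffine S) (i : Fin n) :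
    DependsOn (fun x => fderiv ℝ f x (Pi.single i 1)) (S.erase i : Finset (Fin n)) := by
  intro x y h
  have : ∀ s, f (Function.update x i s) = f (Function.update y i s) := fun s =>
    hf.2.1 fun j hj => by
      by_cases hji : j = i
      · subst hji; simp
      · rw [Function.update_of_ne hji, Function.update_of_ne hji]
        exact h j (by simpa [hji] using hj)
  simp only [partial_of_mem_multiaffine hf, this]

theorem dependsOn_sum {ι : Type*} (s : Finset ι) {c : ι → ℝ} {f : ι → (Fin n → ℝ) → ℝ}
    {S : Set (Fin n)} (h : ∀ i ∈ s, DependsOn (f i) S) :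
    DependsOn (fun x => ∑ i ∈ s, c i * f i x) S := fun _ _ hxy =>
  Finset.sum_congr rfl fun i hi => by rw [h i hi hxy]

variable (K : BoxIntegral.Box (Fin n))

theorem isOpen_cellInterior : IsOpen (cellInterior K) :=
  isOpen_set_pi Set.finite_univ fun _ _ => isOpen_Ioo

theorem volume_cellInterior_lt_top : volume (cellInterior K) < ⊤ :=
  (measure_mono K.Ioo_subset_Icc).trans_lt (BoxIntegral.Box.isCompact_Icc K).measure_lt_top

instance : IsFiniteMeasure (volume.restrict (cellInterior K)) :=
  ⟨by simpa using volume_cellInterior_lt_top K⟩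

theorem volume_cellInterior_pos : 0 < volume.real (cellInterior K) := by
  refine ENNReal.toReal_pos ?_ (volume_cellInterior_lt_top K).ne
  refine ((isOpen_cellInterior K).measure_pos volume ?_).ne'
  exact Set.univ_pi_nonempty_iff.2 fun i => Set.nonempty_Ioo.2 (K.lower_lt_upper i)

theorem memLp_cellInterior {f : (Fin n → ℝ) → ℝ} (hf : Continuous f) :
    MemLp f 2 (volume.restrict (cellInterior K)) := by
  obtain ⟨C, hC⟩ := (BoxIntegral.Box.isCompact_Icc K).exists_bound_of_continuousOn
    hf.continuousOn
  refine MemLp.of_bound hf.aestronglyMeasurable C ?_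
  filter_upwards [ae_restrict_mem (isOpen_cellInterior K).measurableSet] with x hx
  exact hC x (K.Ioo_subset_Icc hx)

theorem SmoothForm.memL2 {k : ℕ} {ω : Form n} (h : SmoothForm ω) (hd : IsDeg k ω) :
    MemL2 k (cellInterior K) ω := ⟨hd, fun σ => memLp_cellInterior K (h σ).continuous⟩

theorem SmoothForm.isWeakD {k : ℕ} {ω : Form n} (h : SmoothForm ω) (hd : IsDeg k ω) :
    IsWeakD k (cellInterior K) ω (CubicalWhitney.extd ω) :=
  ⟨h.extd.memL2 K hd.extd, fun _ hφ => ip_extd hd h hφ.smoothForm (.inr hφ.2.2)⟩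

theorem SmoothForm.isWeakCod {k : ℕ} {μ : Form n} (h : SmoothForm μ) (hd : IsDeg (k + 1) μ) :
    IsWeakCod k (cellInterior K) μ (CubicalWhitney.codiff (k + 1) μ) :=
  ⟨(h.codiff _).memL2 K hd.codiff, fun φ hφ => by
    rw [ip_comm, ip_comm _ μ, ip_extd hφ.1 hφ.smoothForm h (.inl hφ.2.2)]⟩

/-- Fubini on the splitting of the box into two sub-boxes. The factor `|K|` on the left compensates
for each integral on the right containing the volume of the other sub-box. -/
theorem volume_mul_integral_mul {f g : (Fin n → ℝ) → ℝ} (p : Fin n → Prop) [DecidablePred p]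
    (hf : DependsOn f {i | p i}) (hg : DependsOn g {i | ¬p i}) :
    volume.real (cellInterior K) * ∫ x in cellInterior K, f x * g x =
      (∫ x in cellInterior K, f x) * ∫ x in cellInterior K, g x := by
  set ν : Fin n → Measure ℝ := fun i => volume.restrict (Set.Ioo (K.lower i) (K.upper i))
  have hν : volume.restrict (cellInterior K) = Measure.pi ν := by
    rw [volume_pi]
    exact Measure.restrict_pi_pi _ _
  set e := MeasurableEquiv.piEquivPiSubtypeProd (fun _ : Fin n => ℝ) p
  have mp := measurePreserving_piEquivPiSubtypeProd ν p
  have key : ∀ (F : ({i // p i} → ℝ) → ℝ) (G : ({i // ¬p i} → ℝ) → ℝ),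
      ∫ x in cellInterior K, F (e x).1 * G (e x).2 =
        (∫ y, F y ∂Measure.pi fun i : {i // p i} => ν i) *
          ∫ z, G z ∂Measure.pi fun i : {i // ¬p i} => ν i := fun F G => by
    rw [hν, mp.integral_comp' (f := e) (g := fun p => F p.1 * G p.2), integral_prod_mul]
  -- The missing coordinates are filled with 0; their values do not matter to `f`.
  have hF : ∀ x, f x = f (e.symm ((e x).1, 0)) := fun x => hf fun i hi => by
    have hi' : p i := hi
    simp [e, MeasurableEquiv.piEquivPiSubtypeProd, Equiv.piEquivPiSubtypeProd, hi']
  have hG : ∀ x, g x = g (e.symm (0, (e x).2)) := fun x => hg fun i hi => by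
    have hi' : ¬p i := hi
    simp [e, MeasurableEquiv.piEquivPiSubtypeProd, Equiv.piEquivPiSubtypeProd, hi']
  -- The four instances are the integrals of `f * g`, `f`, `g` and `1`.
  have h1 := key (fun y => f (e.symm (y, 0))) (fun z => g (e.symm (0, z)))
  have h2 := key (fun y => f (e.symm (y, 0))) (fun z => 1)
  have h3 := key (fun y => 1) (fun z => g (e.symm (0, z)))
  have h4 := key (fun y => 1) (fun z => 1)
  simp only [← hF, ← hG, mul_one, one_mul] at h1 h2 h3 h4
  rw [h1, h2, h3]
  have h5 : volume.real (cellInterior K) = ∫ x in cellInterior K, (1 : ℝ) := by simp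
  rw [h5, h4]
  ring

theorem volume_mul_ip {k : ℕ} {ω η : Form n} (hω : MemL2 k (cellInterior K) ω)
    (hη : MemL2 k (cellInterior K) η)
    (h : ∀ σ : Finset (Fin n), DependsOn (fun x => ω x σ) ((σᶜ : Finset (Fin n)) : Set (Fin n)))
    (h' : ∀ σ : Finset (Fin n), DependsOn (fun x => η x σ) (σ : Set (Fin n))) :
    volume.real (cellInterior K) * ip (cellInterior K) ω η =
      ∑ σ, (∫ x in cellInterior K, ω x σ) * ∫ x in cellInterior K, η x σ := by
  unfold ip
  rw [integral_finsetSum Finset.univ (f := fun σ x => ω x σ * η x σ)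
    fun σ _ => (hω.2 σ).integrable_mul (hη.2 σ), Finset.mul_sum]
  refine Finset.sum_congr rfl fun σ _ => ?_
  refine volume_mul_integral_mul K (fun i => i ∉ σ) ?_ ?_
  · convert h σ
    ext i
    simp
  · convert h' σ
    ext i
    simp

/-! ### Tensor product forms and Whitney forms on a cell. -/

/-- The coefficient of `dx^α` is multiaffine and depends on the `x_i` with `i ∉ α` only. -/
structure IsQ (k : ℕ) (ω : Form n) : Prop where
  deg : IsDeg k ω
  mem : ∀ α, (fun x => ω x α) ∈ multiaffine αᶜ

/-- The coefficient of `dx^β` is multiaffine and depends on the `x_i` with `i ∈ β` only. -/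
structure IsQs (k : ℕ) (μ : Form n) : Prop where
  deg : IsDeg k μ
  mem : ∀ β, (fun x => μ x β) ∈ multiaffine β

theorem IsQ.smooth {k : ℕ} {ω : Form n} (h : IsQ k ω) : SmoothForm ω := fun σ => (h.mem σ).1

theorem IsQs.smooth {k : ℕ} {ω : Form n} (h : IsQs k ω) : SmoothForm ω := fun σ => (h.mem σ).1

theorem IsQ.add {k : ℕ} {ω η : Form n} (h : IsQ k ω) (h' : IsQ k η) : IsQ k (ω + η) :=
  ⟨fun x σ hσ => by simp [h.deg x σ hσ, h'.deg x σ hσ],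
    fun α => (multiaffine αᶜ).add_mem (h.mem α) (h'.mem α)⟩

theorem IsQ.smul {k : ℕ} (c : ℝ) {ω : Form n} (h : IsQ k ω) : IsQ k (c • ω) :=
  ⟨fun x σ hσ => by simp [h.deg x σ hσ],
    fun α => (multiaffine αᶜ).smul_mem c (h.mem α)⟩

theorem isQ_zero (k : ℕ) : IsQ k (0 : Form n) :=
  ⟨fun _ _ _ => rfl, fun α => (multiaffine αᶜ).zero_mem⟩

theorem IsQ.hodge {k m : ℕ} (hkm : k + m = n) {ω : Form n} (h : IsQ k ω) :
    IsQs m (CubicalWhitney.hodge ω) :=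
  ⟨h.deg.hodge hkm, fun β => by
    have := (multiaffine βᶜᶜ).smul_mem (starSign βᶜ) (h.mem βᶜ)
    rwa [compl_compl] at this⟩

/-- The coefficient at `ρ \ {i}` may involve `x_i` and the variables outside `ρ`; applying `∂ᵢ`
removes `x_i`. -/
theorem IsQ.dependsOn_extd {k : ℕ} {ω : Form n} (h : IsQ k ω) (ρ : Finset (Fin n)) :
    DependsOn (fun x => extd ω x ρ) ((ρᶜ : Finset (Fin n)) : Set (Fin n)) := by
  refine dependsOn_sum ρ fun i hi => ?_
  have := dependsOn_partial (h.mem (ρ.erase i)) i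
  rwa [compl_erase, Finset.erase_insert (by simpa using hi)] at this

theorem IsQs.dependsOn_codiff {k : ℕ} {μ : Form n} (h : IsQs (k + 1) μ) (α : Finset (Fin n)) :
    DependsOn (fun x => codiff (k + 1) μ x α) (α : Set (Fin n)) := by
  by_cases hα : α.card = k
  · simp_rw [codiff_apply μ _ hα fun τ => h.smooth.differentiable τ _]
    have : DependsOn (fun x => ∑ i ∈ αᶜ, insSign i α *
        fderiv ℝ (fun y => μ y (insert i α)) x (Pi.single i 1)) (α : Set (Fin n)) := by
      refine dependsOn_sum αᶜ fun i hi => ?_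
      have := dependsOn_partial (h.mem (insert i α)) i
      rwa [Finset.erase_insert (by simpa using hi)] at this
    exact fun x y hxy => congrArg Neg.neg (this hxy)
  · have : ∀ x, codiff (k + 1) μ x α = 0 := fun x => h.deg.codiff x α hα
    simp_rw [this]
    exact fun _ _ _ => rfl

theorem isQ_of_mem_Q1m {k : ℕ} {ω : Form n} (h : ω ∈ Q1m n k) : IsQ k ω := by
  refine Submodule.span_induction (fun ω h => ?_) (isQ_zero k) (fun _ _ _ _ => IsQ.add)
    (fun c _ _ => IsQ.smul c) h
  obtain ⟨α, p, hα, hp, rfl⟩ := h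
  refine ⟨fun x σ hσ => ?_, fun σ => ?_⟩
  · have hne : σ ≠ α := fun h => hσ (h ▸ hα)
    simp [Pi.single_eq_of_ne hne]
  by_cases hσ : σ = α
  · subst hσ
    simp only [Pi.single_eq_same]
    refine prod_mem_multiaffine fun i => ?_
    have := hp i
    by_cases hi : i ∈ σ <;> simp_all
  · simp only [Pi.single_eq_of_ne hσ]
    exact const_mem_multiaffine _ 0

theorem isQ_of_mem_P0 {k : ℕ} {ω : Form n} (h : ω ∈ P0 n k) : IsQ k ω := by
  obtain ⟨hd, c, rfl⟩ := h
  exact ⟨hd, fun α => const_mem_multiaffine _ _⟩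

theorem isDeg_koszul {k : ℕ} {e : Form n} (h : IsDeg (k + 1) e) : IsDeg k (koszul e) :=
  fun x σ hσ => Finset.sum_eq_zero fun i hi => by
    rw [h x (insert i σ), mul_zero]
    rw [Finset.card_insert_of_notMem (Finset.mem_compl.1 hi)]
    omega

theorem isQ_koszul {k : ℕ} {e : Form n} (h : e ∈ P0 n (k + 1)) : IsQ k (koszul e) := by
  refine ⟨isDeg_koszul h.1, fun α => ?_⟩
  obtain ⟨hd, c, rfl⟩ := h
  have : (fun x => koszul (fun _ => c) x α) =
      ∑ i ∈ αᶜ, (insSign i α * c (insert i α)) • fun x : Fin n → ℝ => x i := by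
    funext x
    simp only [koszul, LinearMap.coe_mk, AddHom.coe_mk, Finset.sum_apply, Pi.smul_apply,
      smul_eq_mul]
    exact Finset.sum_congr rfl fun i _ => by ring
  rw [this]
  exact Submodule.sum_mem _ fun i hi => Submodule.smul_mem _ _ (coord_mem_multiaffine hi)

theorem mem_P1m {k : ℕ} {ω : Form n} :
    ω ∈ P1m n k ↔ ∃ c ∈ P0 n k, ∃ e ∈ P0 n (k + 1), ω = c + koszul e := by
  simp only [P1m, Submodule.mem_sup, Submodule.mem_map]
  constructor
  · rintro ⟨c, hc, _, ⟨e, he, rfl⟩, rfl⟩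
    exact ⟨c, hc, e, he, rfl⟩
  · rintro ⟨c, hc, e, he, rfl⟩
    exact ⟨c, hc, _, ⟨e, he, rfl⟩, rfl⟩

/-- The `dx^α` coefficient of `κ e` is a linear combination of the `x_i` with `i ∉ α`. Hence the
factorization also applies to interpolants. -/
theorem isQ_of_mem_P1m {k : ℕ} {ω : Form n} (h : ω ∈ P1m n k) : IsQ k ω := by
  obtain ⟨c, hc, e, he, rfl⟩ := mem_P1m.1 h
  exact (isQ_of_mem_P0 hc).add (isQ_koszul he)

theorem isQs_of_mem_Q1s {k : ℕ} (hk : k ≤ n) {μ : Form n} (h : μ ∈ Q1s n k) : IsQs k μ := by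
  rw [Q1s, if_pos hk] at h
  obtain ⟨ω, hω, rfl⟩ := h
  exact (isQ_of_mem_Q1m hω).hodge (by omega)

theorem isQs_of_mem_P1s {k : ℕ} (hk : k ≤ n) {μ : Form n} (h : μ ∈ P1s n k) : IsQs k μ := by
  rw [P1s, if_pos hk] at h
  obtain ⟨ω, hω, rfl⟩ := h
  exact (isQ_of_mem_P1m hω).hodge (by omega)

theorem hodge_mem_P0 {k m : ℕ} (h : k + m = n) {c : Form n} (hc : c ∈ P0 n k) :
    hodge c ∈ P0 n m := by
  obtain ⟨hd, c, rfl⟩ := hc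
  exact ⟨hd.hodge h, fun τ => starSign τᶜ * c τᶜ, rfl⟩

theorem exists_hodge_eq {k m : ℕ} (h : k + m = n) {c : Form n} (hc : c ∈ P0 n m) :
    ∃ c' ∈ P0 n k, hodge c' = c := by
  refine ⟨(-1 : ℝ) ^ (m * k) • hodge c, Submodule.smul_mem _ _ (hodge_mem_P0 (by omega) hc), ?_⟩
  funext x σ
  rw [map_smul]
  simp only [Pi.smul_apply, smul_eq_mul, hodge_hodge]
  by_cases hσ : σ.card = m
  · have := Finset.card_add_card_compl σ
    rw [Fintype.card_fin] at this
    rw [hσ, show σᶜ.card = k by omega, ← mul_assoc, ← mul_pow]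
    simp
  · simp [hc.1 x σ hσ]

theorem wedgeX_smul (r : ℝ) (b : Form n) : wedgeX (r • b) = r • wedgeX b := by
  funext x β
  simp only [wedgeX, Pi.smul_apply, smul_eq_mul, Finset.mul_sum]
  exact Finset.sum_congr rfl fun i _ => by ring

/-- Up to sign, `⋆` exchanges `κ` with `wedgeX` and maps constants onto constants; this yields
explicit test forms. -/
theorem mem_P1s {k : ℕ} (hk : k + 1 ≤ n) {μ : Form n} :
    μ ∈ P1s n (k + 1) ↔ ∃ a ∈ P0 n (k + 1), ∃ b ∈ P0 n k, μ = a + wedgeX b := by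
  rw [P1s, if_pos hk]
  constructor
  · rintro ⟨ω, hω, rfl⟩
    obtain ⟨c, hc, e, he, rfl⟩ := mem_P1m.1 hω
    rw [show n - (k + 1) + 1 = n - k by omega] at he
    refine ⟨hodge c, hodge_mem_P0 (by omega) hc, (-1 : ℝ) ^ (n - k - 1) • hodge e,
      Submodule.smul_mem _ _ (hodge_mem_P0 (by omega) he), ?_⟩
    rw [map_add, hodge_koszul hk he.1, wedgeX_smul]
  · rintro ⟨a, ha, b, hb, rfl⟩
    obtain ⟨c, hc, rfl⟩ := exists_hodge_eq (k := n - (k + 1)) (by omega) ha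
    obtain ⟨e, he, rfl⟩ := exists_hodge_eq (k := n - k) (by omega) hb
    refine ⟨c + koszul ((-1 : ℝ) ^ (n - k - 1) • e), mem_P1m.2 ⟨c, hc, _,
      Submodule.smul_mem _ _ ?_, rfl⟩, ?_⟩
    · rwa [show n - (k + 1) + 1 = n - k by omega]
    · rw [map_add, map_smul, map_smul, hodge_koszul hk he.1, smul_smul, ← mul_pow]
      simp

end

/-! ### Moments and unisolvence of the adjoint projection. -/

section

theorem sum_update_sub {s : Finset (Fin n)} {i : Fin n} (hi : i ∈ s) (x : Fin n → ℝ)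
    (g h : Fin n → ℝ) :
    (∑ j ∈ s, g j * Function.update x i 1 j * h j) - ∑ j ∈ s, g j * Function.update x i 0 j * h j =
      g i * h i := by
  rw [← Finset.sum_sub_distrib, Finset.sum_eq_single i]
  · simp
  · intro j _ hj
    simp [Function.update_of_ne hj]
  · exact fun h => absurd hi h

/-- Each of the `k + 1` indices `i ∈ ρ` contributes exactly `e ρ`. -/
theorem extd_whitney {k : ℕ} {c e : Form n} (hc : c ∈ P0 n k) (he : e ∈ P0 n (k + 1)) :
    extd (c + koszul e) = ((k : ℝ) + 1) • e := by
  have hQ : IsQ k (c + koszul e) := (isQ_of_mem_P0 hc).add (isQ_koszul he)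
  obtain ⟨_, c, rfl⟩ := hc
  obtain ⟨hd, e, rfl⟩ := he
  funext x ρ
  by_cases hρ : ρ.card = k + 1
  · have : ∀ i ∈ ρ, insSign i ρ * fderiv ℝ (fun y => ((fun _ => c) + koszul (fun _ => e) : Form n) y
        (ρ.erase i)) x (Pi.single i 1) = e ρ := fun i hi => by
      rw [partial_of_mem_multiaffine (hQ.mem _)]
      simp only [Pi.add_apply, koszul, LinearMap.coe_mk, AddHom.coe_mk]
      rw [add_sub_add_left_eq_sub, sum_update_sub (by simp), insSign_erase, Finset.insert_erase hi,
        ← mul_assoc, insSign_mul_self, one_mul]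
    rw [extd, Finset.sum_congr rfl this, Finset.sum_const, hρ]
    simp
  · rw [hQ.deg.extd x ρ hρ]
    simp [show e ρ = 0 from hd x ρ hρ]

/-- Each of the `n - k` indices outside `α` contributes exactly `b α`. -/
theorem codiff_wedgeX {k : ℕ} (hk : k + 1 ≤ n) {a b : Form n} (ha : a ∈ P0 n (k + 1))
    (hb : b ∈ P0 n k) : codiff (k + 1) (a + wedgeX b) = (-((n : ℝ) - k)) • b := by
  have hQ : IsQs (k + 1) (a + wedgeX b) :=
    isQs_of_mem_P1s hk ((mem_P1s hk).2 ⟨a, ha, b, hb, rfl⟩)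
  obtain ⟨_, a, rfl⟩ := ha
  obtain ⟨hd, b, rfl⟩ := hb
  funext x α
  by_cases hα : α.card = k
  · have : ∀ i ∈ αᶜ, insSign i α * fderiv ℝ (fun y => ((fun _ => a) + wedgeX (fun _ => b) : Form n) y
        (insert i α)) x (Pi.single i 1) = b α := fun i hi => by
      rw [partial_of_mem_multiaffine (hQ.mem _)]
      simp only [Pi.add_apply, wedgeX]
      rw [add_sub_add_left_eq_sub, sum_update_sub (by simp), insSign_insert,
        Finset.erase_insert (by simpa using hi), ← mul_assoc, insSign_mul_self, one_mul]
    rw [codiff_apply _ _ hα fun τ => hQ.smooth.differentiable τ x, Finset.sum_congr rfl this,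
      Finset.sum_const, Finset.card_compl, hα, Fintype.card_fin]
    simp [Nat.cast_sub (show k ≤ n by omega)]
    ring
  · rw [hQ.deg.codiff x α hα]
    simp [show b α = 0 from hd x α hα]

variable (K : BoxIntegral.Box (Fin n))

/-- The mean values of `dω`, not normalized. -/
def dMoment (k : ℕ) (ω : Form n) (σ : Finset (Fin n)) : ℝ :=
  ∫ x in cellInterior K, wd k (cellInterior K) ω x σ

/-- The values of the pairing of `ω` with the forms `∑ i, x_i dx^i ∧ dx^σ`. -/
def xMoment (k : ℕ) (ω : Form n) (σ : Finset (Fin n)) : ℝ :=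
  ∫ x in cellInterior K, (koszul (wd k (cellInterior K) ω) x σ + ((n : ℝ) - k) * ω x σ)

variable {K}

theorem MemL2.integrable_coeff {k : ℕ} {ω : Form n} (h : MemL2 k (cellInterior K) ω)
    (σ : Finset (Fin n)) : Integrable (fun x => ω x σ) (volume.restrict (cellInterior K)) :=
  (h.2 σ).integrable (by norm_num)

theorem MemL2.integrable_koszul {k : ℕ} {ω : Form n} (h : MemL2 k (cellInterior K) ω)
    (σ : Finset (Fin n)) :
    Integrable (fun x => koszul ω x σ) (volume.restrict (cellInterior K)) := by
  simp only [koszul, LinearMap.coe_mk, AddHom.coe_mk]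
  refine integrable_finsetSum _ fun i _ => ?_
  have := memLp_cellInterior K (f := fun x => insSign i σ * x i) (by fun_prop)
  exact this.integrable_mul (h.2 (insert i σ))

theorem HL.isWeakD {k : ℕ} {U : Set (Fin n → ℝ)} {ω : Form n} (h : ω ∈ HL k U) :
    IsWeakD k U ω (wd k U ω) := isWeakD_wd h.2.choose_spec

theorem HsL.isWeakCod {k : ℕ} {U : Set (Fin n → ℝ)} {ω : Form n} (h : ω ∈ HsL k U) :
    IsWeakCod k U ω (wcod k U ω) := isWeakCod_wcod h.2.choose_spec

theorem IsQ.mem_HL {k : ℕ} {ω : Form n} (h : IsQ k ω) : ω ∈ HL k (cellInterior K) :=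
  ⟨h.smooth.memL2 K h.deg, _, h.smooth.isWeakD K h.deg⟩

theorem IsQ.wd_ae_eq {k : ℕ} {ω : Form n} (h : IsQ k ω) :
    wd k (cellInterior K) ω =ᵐ[volume.restrict (cellInterior K)] extd ω :=
  (h.smooth.isWeakD K h.deg).wd_ae_eq (isOpen_cellInterior K)

theorem IsQs.wcod_ae_eq {k : ℕ} {ω : Form n} (h : IsQs (k + 1) ω) :
    wcod k (cellInterior K) ω =ᵐ[volume.restrict (cellInterior K)] codiff (k + 1) ω :=
  (h.smooth.isWeakCod K h.deg).wcod_ae_eq (isOpen_cellInterior K)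

/-- `wedgeX` is moved onto `dω` as `κ`, and `δ (a + wedgeX b) = -(n - k) b` supplies the second term
of `xMoment`. -/
theorem pairing_eq_moments {k : ℕ} (hk : k + 1 ≤ n) {ω : Form n}
    (hω : ω ∈ HL k (cellInterior K)) {a b : Cov n} (ha : (fun _ => a) ∈ P0 n (k + 1))
    (hb : (fun _ => b) ∈ P0 n k) :
    pairing k (cellInterior K) ω ((fun _ => a) + wedgeX fun _ => b) =
      ∑ σ, a σ * dMoment K k ω σ + ∑ σ, b σ * xMoment K k ω σ := by
  set μ : Form n := (fun _ => a) + wedgeX fun _ => b with hμ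
  have hQ : IsQs (k + 1) μ := isQs_of_mem_P1s hk ((mem_P1s hk).2 ⟨_, ha, _, hb, rfl⟩)
  have hd := HL.isWeakD hω
  have hc := hQ.wcod_ae_eq (K := K)
  rw [codiff_wedgeX hk ha hb] at hc
  have hbL : MemL2 k (cellInterior K) ((-((n : ℝ) - k)) • fun _ => b : Form n) := by
    rw [← codiff_wedgeX hk ha hb]
    exact (hQ.smooth.codiff _).memL2 K hQ.deg.codiff
  rw [pairing, ip_congr (ae_eq_refl _) hc]
  unfold ip
  rw [← integral_sub (hd.1.integrable (hQ.smooth.memL2 K hQ.deg)) (hω.1.integrable hbL)]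
  simp only [dMoment, xMoment, ← integral_const_mul]
  have i1 : ∀ σ, Integrable (fun x => a σ * wd k (cellInterior K) ω x σ)
      (volume.restrict (cellInterior K)) := fun σ => (hd.1.integrable_coeff σ).const_mul _
  have i2 : ∀ σ, Integrable (fun x => b σ * (koszul (wd k (cellInterior K) ω) x σ +
      ((n : ℝ) - k) * ω x σ)) (volume.restrict (cellInterior K)) := fun σ =>
    ((hd.1.integrable_koszul σ).add ((hω.1.integrable_coeff σ).const_mul _)).const_mul _
  rw [← integral_finsetSum _ fun σ _ => i1 σ, ← integral_finsetSum _ fun σ _ => i2 σ,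
    ← integral_add (integrable_finsetSum _ fun σ _ => i1 σ)
      (integrable_finsetSum _ fun σ _ => i2 σ)]
  refine integral_congr_ae (.of_forall fun x => ?_)
  simp only [hμ, Pi.add_apply, mul_add, Finset.sum_add_distrib]
  rw [sum_mul_wedgeX]
  have e1 : ∑ σ, ω x σ * ((-((n : ℝ) - k)) • fun _ => b : Form n) x σ =
      -∑ σ, b σ * (((n : ℝ) - k) * ω x σ) := by
    rw [← Finset.sum_neg_distrib]
    refine Finset.sum_congr rfl fun σ _ => ?_
    simp only [Pi.smul_apply, smul_eq_mul]
    ring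
  have e2 : ∑ σ, wd k (cellInterior K) ω x σ * a σ = ∑ σ, a σ * wd k (cellInterior K) ω x σ :=
    Finset.sum_congr rfl fun σ _ => mul_comm _ _
  have e3 : ∑ σ, koszul (fun _ => wd k (cellInterior K) ω x) x σ * b σ =
      ∑ σ, b σ * koszul (wd k (cellInterior K) ω) x σ :=
    Finset.sum_congr rfl fun σ _ => mul_comm _ _
  rw [e1, e2, e3]
  ring

theorem single_mem_P0 (σ : Finset (Fin n)) : (fun _ => Pi.single σ 1) ∈ P0 n σ.card := by
  refine ⟨fun x τ hτ => ?_, _, rfl⟩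
  have hne : τ ≠ σ := fun h => hτ (h ▸ rfl)
  simp [Pi.single_eq_of_ne hne]

theorem dMoment_eq_zero {k : ℕ} {ω : Form n} (hω : ω ∈ HL k (cellInterior K))
    {σ : Finset (Fin n)} (hσ : σ.card ≠ k + 1) : dMoment K k ω σ = 0 := by
  simp [dMoment, (HL.isWeakD hω).1.1 _ σ hσ]

theorem xMoment_eq_zero {k : ℕ} {ω : Form n} (hω : ω ∈ HL k (cellInterior K))
    {σ : Finset (Fin n)} (hσ : σ.card ≠ k) : xMoment K k ω σ = 0 := by
  simp [xMoment, isDeg_koszul (HL.isWeakD hω).1.1 _ σ hσ, hω.1.1 _ σ hσ]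

theorem forall_pairing_eq_iff {k : ℕ} (hk : k + 1 ≤ n) {ω η : Form n}
    (hω : ω ∈ HL k (cellInterior K)) (hη : η ∈ HL k (cellInterior K)) :
    (∀ μ ∈ P1s n (k + 1), pairing k (cellInterior K) η μ = pairing k (cellInterior K) ω μ) ↔
      dMoment K k η = dMoment K k ω ∧ xMoment K k η = xMoment K k ω := by
  constructor
  · refine fun h => ⟨funext fun σ => ?_, funext fun σ => ?_⟩
    · by_cases hσ : σ.card = k + 1
      · have ha := single_mem_P0 σ
        rw [hσ] at ha
        have hb : (fun _ => (0 : Cov n)) ∈ P0 n k := (P0 n k).zero_mem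
        have := h _ ((mem_P1s hk).2 ⟨_, ha, _, hb, rfl⟩)
        rw [pairing_eq_moments hk hη ha hb, pairing_eq_moments hk hω ha hb] at this
        simpa [Pi.single_apply] using this
      · rw [dMoment_eq_zero hω hσ, dMoment_eq_zero hη hσ]
    · by_cases hσ : σ.card = k
      · have hb := single_mem_P0 σ
        rw [hσ] at hb
        have ha : (fun _ => (0 : Cov n)) ∈ P0 n (k + 1) := (P0 n (k + 1)).zero_mem
        have := h _ ((mem_P1s hk).2 ⟨_, ha, _, hb, rfl⟩)
        rw [pairing_eq_moments hk hη ha hb, pairing_eq_moments hk hω ha hb] at this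
        simpa [Pi.single_apply] using this
      · rw [xMoment_eq_zero hω hσ, xMoment_eq_zero hη hσ]
  · rintro ⟨h1, h2⟩ μ hμ
    obtain ⟨a, ha, b, hb, rfl⟩ := (mem_P1s hk).1 hμ
    obtain ⟨_, a, rfl⟩ := id ha
    obtain ⟨_, b, rfl⟩ := id hb
    rw [pairing_eq_moments hk hη ha hb, pairing_eq_moments hk hω ha hb, h1, h2]

theorem dMoment_whitney {k : ℕ} {c e : Cov n} (hc : (fun _ => c) ∈ P0 n k)
    (he : (fun _ => e) ∈ P0 n (k + 1)) (σ : Finset (Fin n)) :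
    dMoment K k ((fun _ => c) + koszul fun _ => e) σ =
      ((k : ℝ) + 1) * volume.real (cellInterior K) * e σ := by
  have h := ((isQ_of_mem_P0 hc).add (isQ_koszul he)).wd_ae_eq (K := K)
  rw [extd_whitney hc he] at h
  have : dMoment K k ((fun _ => c) + koszul fun _ => e) σ =
      ∫ x in cellInterior K, ((k : ℝ) + 1) * e σ :=
    integral_congr_ae (by filter_upwards [h] with x hx; simp [hx])
  rw [this]
  simp
  ring

/-- The factor `n + 1` is `(k + 1) + (n - k)`: `κ e` comes once from `κ d κ e = (k + 1) κ e` and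
once from `(n - k) ω`. -/
theorem xMoment_whitney {k : ℕ} {c e : Cov n} (hc : (fun _ => c) ∈ P0 n k)
    (he : (fun _ => e) ∈ P0 n (k + 1)) (σ : Finset (Fin n)) :
    xMoment K k ((fun _ => c) + koszul fun _ => e) σ =
      ((n : ℝ) - k) * volume.real (cellInterior K) * c σ +
        ((n : ℝ) + 1) * ∫ x in cellInterior K, koszul (fun _ => e) x σ := by
  have h := ((isQ_of_mem_P0 hc).add (isQ_koszul he)).wd_ae_eq (K := K)
  rw [extd_whitney hc he] at h
  have h1 : xMoment K k ((fun _ => c) + koszul fun _ => e) σ =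
      ∫ x in cellInterior K, (((n : ℝ) - k) * c σ + ((n : ℝ) + 1) * koszul (fun _ => e) x σ) := by
    refine integral_congr_ae ?_
    filter_upwards [h] with x hx
    have : koszul (wd k (cellInterior K) ((fun _ => c) + koszul fun _ => e)) x σ =
        koszul (((k : ℝ) + 1) • fun _ => e : Form n) x σ := by
      simp only [koszul, LinearMap.coe_mk, AddHom.coe_mk] at hx ⊢
      rw [hx]
    rw [this, map_smul]
    simp only [Pi.add_apply, Pi.smul_apply, smul_eq_mul]
    ring
  rw [h1, integral_add (integrable_const _), integral_const_mul ((n : ℝ) + 1)]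
  · simp
    ring
  · have hQ := isQ_koszul he
    exact ((hQ.smooth.memL2 K hQ.deg).integrable_coeff σ).const_mul _

/-- The moment system is triangular with pivots `(k + 1)|K|` for `e` and `(n - k)|K|` for `c`; the
latter is nonzero because `k < n`. -/
theorem existsUnique_isAdjProj_of_lt {k : ℕ} (hk : k + 1 ≤ n) {ω : Form n}
    (hω : ω ∈ HL k (cellInterior K)) : ∃! η, IsAdjProj k (cellInterior K) ω η := by
  have hV := (volume_cellInterior_pos K).ne'
  have hk1 : (k : ℝ) + 1 ≠ 0 := by positivity
  have hnk : (n : ℝ) - k ≠ 0 := by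
    have : (k : ℝ) < n := by exact_mod_cast hk
    linarith
  refine existsUnique_of_exists_of_unique ?_ ?_
  · set e : Cov n := fun σ => dMoment K k ω σ / (((k : ℝ) + 1) * volume.real (cellInterior K))
      with he
    set c : Cov n := fun σ => (xMoment K k ω σ -
      ((n : ℝ) + 1) * ∫ x in cellInterior K, koszul (fun _ => e) x σ) /
        (((n : ℝ) - k) * volume.real (cellInterior K)) with hc
    have he0 : (fun _ => e) ∈ P0 n (k + 1) :=
      ⟨fun x σ hσ => by simp [he, dMoment_eq_zero hω hσ], e, rfl⟩
    have hc0 : (fun _ => c) ∈ P0 n k :=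
      ⟨fun x σ hσ => by simp [hc, xMoment_eq_zero hω hσ, isDeg_koszul he0.1 _ σ hσ], c, rfl⟩
    have hη : (fun _ => c) + koszul (fun _ => e) ∈ P1m n k := mem_P1m.2 ⟨_, hc0, _, he0, rfl⟩
    refine ⟨_, hη, (forall_pairing_eq_iff hk hω (isQ_of_mem_P1m hη).mem_HL).2
      ⟨funext fun σ => ?_, funext fun σ => ?_⟩, fun h => by omega⟩
    · rw [dMoment_whitney hc0 he0, he]
      field_simp
    · rw [xMoment_whitney hc0 he0]
      have : ((n : ℝ) - k) * volume.real (cellInterior K) * c σ = xMoment K k ω σ -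
          ((n : ℝ) + 1) * ∫ x in cellInterior K, koszul (fun _ => e) x σ := by
        simp only [hc]
        field_simp
      rw [this]
      ring
  · rintro η η' ⟨h1, h2, _⟩ ⟨h1', h2', _⟩
    have m := (forall_pairing_eq_iff hk hω (isQ_of_mem_P1m h1).mem_HL).1 h2
    have m' := (forall_pairing_eq_iff hk hω (isQ_of_mem_P1m h1').mem_HL).1 h2'
    rw [← m'.1, ← m'.2] at m
    obtain ⟨c, hc, e, he, rfl⟩ := mem_P1m.1 h1
    obtain ⟨c', hc', e', he', rfl⟩ := mem_P1m.1 h1'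
    obtain ⟨_, c, rfl⟩ := id hc
    obtain ⟨_, e, rfl⟩ := id he
    obtain ⟨_, c', rfl⟩ := id hc'
    obtain ⟨_, e', rfl⟩ := id he'
    have hee : e = e' := funext fun σ => by
      have := congrFun m.1 σ
      rw [dMoment_whitney hc he, dMoment_whitney hc' he'] at this
      exact mul_left_cancel₀ (mul_ne_zero hk1 hV) this
    subst hee
    have hcc : c = c' := funext fun σ => by
      have := congrFun m.2 σ
      rw [xMoment_whitney hc he, xMoment_whitney hc' he', add_left_inj] at this
      exact mul_left_cancel₀ (mul_ne_zero hnk hV) this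
    rw [hcc]

theorem isDeg_eq_zero {k : ℕ} (hk : n < k) {ω : Form n} (h : IsDeg k ω) : ω = 0 := by
  funext x σ
  refine h x σ fun h' => ?_
  have := σ.card_le_univ
  rw [Fintype.card_fin] at this
  omega

theorem pairing_zero_right {k : ℕ} (U : Set (Fin n → ℝ)) (hU : IsOpen U) (ω : Form n) :
    pairing k U ω 0 = 0 := by
  have : IsWeakCod k U (0 : Form n) 0 :=
    ⟨⟨fun _ _ _ => rfl, fun _ => MemLp.zero⟩, fun φ _ => by simp [ip]⟩
  rw [pairing, ip_congr (ae_eq_refl ω) (this.wcod_ae_eq hU)]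
  simp [ip]

theorem ip_const_right {k : ℕ} {ω : Form n} (hω : MemL2 k (cellInterior K) ω) (c : Cov n) :
    ip (cellInterior K) ω (fun _ => c) = ∑ σ, (∫ x in cellInterior K, ω x σ) * c σ := by
  unfold ip
  rw [integral_finsetSum _ fun σ _ => (hω.integrable_coeff σ).mul_const _]
  simp_rw [integral_mul_const]

/-- In top degree `κ` contributes nothing, the pairing conditions are void, and the projection to
constants is the mean value. -/
theorem existsUnique_isAdjProj_top {ω : Form n}
    (hω : ω ∈ HL n (cellInterior K)) : ∃! η, IsAdjProj n (cellInterior K) ω η := by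
  have hV := (volume_cellInterior_pos K).ne'
  have hP : ∀ η : Form n, η ∈ P1m n n ↔ η ∈ P0 n n := fun η => by
    rw [mem_P1m]
    constructor
    · rintro ⟨c, hc, e, he, rfl⟩
      rwa [isDeg_eq_zero (Nat.lt_succ_self n) he.1, map_zero, add_zero]
    · exact fun h => ⟨η, h, 0, (P0 n (n + 1)).zero_mem, by simp⟩
  refine existsUnique_of_exists_of_unique ?_ ?_
  · set c : Cov n := fun σ => (∫ x in cellInterior K, ω x σ) / volume.real (cellInterior K) with hc
    have hc0 : (fun _ => c) ∈ P0 n n := ⟨fun x σ hσ => by simp [hc, hω.1.1 _ σ hσ], c, rfl⟩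
    have hQ := isQ_of_mem_P0 hc0
    refine ⟨fun _ => c, (hP _).2 hc0, fun μ hμ => ?_, ?_⟩
    · rw [P1s, if_neg (by omega), Submodule.mem_bot] at hμ
      rw [hμ, pairing_zero_right _ (isOpen_cellInterior K),
        pairing_zero_right _ (isOpen_cellInterior K)]
    · rintro - _ ⟨_, d, rfl⟩
      rw [ip_const_right (hQ.smooth.memL2 K hQ.deg), ip_const_right hω.1]
      refine Finset.sum_congr rfl fun σ _ => ?_
      simp only [hc, integral_const, MeasurableSet.univ, measureReal_restrict_apply, Set.univ_inter,
        smul_eq_mul]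
      rw [mul_div_cancel₀ _ hV]
  · rintro η η' ⟨h1, _, h2⟩ ⟨h1', _, h2'⟩
    obtain ⟨hd, c, rfl⟩ := (hP _).1 h1
    obtain ⟨hd', c', rfl⟩ := (hP _).1 h1'
    have hQ := isQ_of_mem_P1m h1
    have hQ' := isQ_of_mem_P1m h1'
    funext x σ
    by_cases hσ : σ.card = n
    · have h0 := single_mem_P0 σ
      rw [hσ] at h0
      have := (h2 rfl _ h0).trans (h2' rfl _ h0).symm
      rw [ip_const_right (hQ.smooth.memL2 K hQ.deg), ip_const_right (hQ'.smooth.memL2 K hQ'.deg)]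
        at this
      simpa [Pi.single_apply, hV] using this
    · exact (hd x σ hσ).trans (hd' x σ hσ).symm

theorem existsUnique_isAdjProj {k : ℕ} (hk : k ≤ n) {ω : Form n}
    (hω : ω ∈ HL k (cellInterior K)) : ∃! η, IsAdjProj k (cellInterior K) ω η := by
  rcases hk.lt_or_eq with h | rfl
  · exact existsUnique_isAdjProj_of_lt h hω
  · exact existsUnique_isAdjProj_top hω

theorem isAdjProj_adjProj {k : ℕ} (hk : k ≤ n) {ω : Form n}
    (hω : ω ∈ HL k (cellInterior K)) :
    IsAdjProj k (cellInterior K) ω (adjProj k (cellInterior K) ω) := by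
  have h := (existsUnique_isAdjProj hk hω).exists
  rw [adjProj, dif_pos h]
  exact h.choose_spec

/-! ### The pairing on tensor product spaces. -/

theorem pairing_congr {k : ℕ} {U : Set (Fin n → ℝ)} (hU : IsOpen U) {ω ω' μ μ' dω δμ : Form n}
    (hω : ω =ᵐ[volume.restrict U] ω') (hμ : μ =ᵐ[volume.restrict U] μ')
    (hd : IsWeakD k U ω' dω) (hδ : IsWeakCod k U μ' δμ) :
    pairing k U ω μ = ip U dω μ' - ip U ω' δμ := by
  rw [pairing, ip_congr ((hd.congr hω.symm).wd_ae_eq hU) hμ,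
    ip_congr hω ((hδ.congr hμ.symm).wcod_ae_eq hU)]

/-- On the tensor product spaces the pairing depends on mean values only. -/
theorem volume_mul_pairing {k : ℕ} {ω μ p q : Form n}
    (hω : ω =ᵐ[volume.restrict (cellInterior K)] p)
    (hμ : μ =ᵐ[volume.restrict (cellInterior K)] q) (hp : IsQ k p) (hq : IsQs (k + 1) q) :
    volume.real (cellInterior K) * pairing k (cellInterior K) ω μ =
      ∑ σ, (∫ x in cellInterior K, extd p x σ) * (∫ x in cellInterior K, q x σ) -
        ∑ σ, (∫ x in cellInterior K, p x σ) * ∫ x in cellInterior K, codiff (k + 1) q x σ := by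
  rw [pairing_congr (isOpen_cellInterior K) hω hμ (hp.smooth.isWeakD K hp.deg)
    (hq.smooth.isWeakCod K hq.deg), mul_sub,
    volume_mul_ip K (hp.smooth.extd.memL2 K hp.deg.extd) (hq.smooth.memL2 K hq.deg)
      hp.dependsOn_extd fun σ => (hq.mem σ).2.1,
    volume_mul_ip K (hp.smooth.memL2 K hp.deg) ((hq.smooth.codiff _).memL2 K hq.deg.codiff)
      (fun σ => (hp.mem σ).2.1) hq.dependsOn_codiff]

/-- In `a + wedgeX b`, the constant `b` is fixed by the mean of `δq`, since `δ (a + wedgeX b) = -(n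
- k) b`; then `a` corrects the mean of the form itself. -/
theorem exists_mem_P1s_mean_eq {k : ℕ} (hk : k + 1 ≤ n) {q : Form n} (hq : IsQs (k + 1) q) :
    ∃ q' ∈ P1s n (k + 1), (∀ σ, ∫ x in cellInterior K, q' x σ = ∫ x in cellInterior K, q x σ) ∧
      ∀ σ, ∫ x in cellInterior K, codiff (k + 1) q' x σ =
        ∫ x in cellInterior K, codiff (k + 1) q x σ := by
  have hV := (volume_cellInterior_pos K).ne'
  have hnk : (n : ℝ) - k ≠ 0 := by
    have : (k : ℝ) < n := by exact_mod_cast hk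
    linarith
  set b : Cov n := fun σ => (∫ x in cellInterior K, codiff (k + 1) q x σ) /
    (-((n : ℝ) - k) * volume.real (cellInterior K)) with hb
  have hb0 : (fun _ => b) ∈ P0 n k := ⟨fun x σ hσ => by simp [hb, hq.deg.codiff _ σ hσ], b, rfl⟩
  have hX : IsQs (k + 1) (wedgeX fun _ => b) := by
    have := (mem_P1s hk).2 ⟨0, (P0 n (k + 1)).zero_mem, _, hb0, rfl⟩
    rw [zero_add] at this
    exact isQs_of_mem_P1s hk this
  set a : Cov n := fun σ => ((∫ x in cellInterior K, q x σ) -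
    ∫ x in cellInterior K, wedgeX (fun _ => b) x σ) / volume.real (cellInterior K) with ha
  have ha0 : (fun _ => a) ∈ P0 n (k + 1) :=
    ⟨fun x σ hσ => by simp [ha, hq.deg _ σ hσ, hX.deg _ σ hσ], a, rfl⟩
  refine ⟨_, (mem_P1s hk).2 ⟨_, ha0, _, hb0, rfl⟩, fun σ => ?_, fun σ => ?_⟩
  · simp only [Pi.add_apply]
    rw [integral_add (integrable_const _) ((hX.smooth.memL2 K hX.deg).integrable_coeff σ)]
    simp only [ha, integral_const, MeasurableSet.univ, measureReal_restrict_apply, Set.univ_inter,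
      smul_eq_mul]
    rw [mul_div_cancel₀ _ hV]
    ring
  · rw [codiff_wedgeX hk ha0 hb0]
    simp only [Pi.smul_apply, hb, integral_const, MeasurableSet.univ, measureReal_restrict_apply,
      Set.univ_inter, smul_eq_mul]
    field_simp

theorem IsAdjProj.pairing_eq {k : ℕ} (hk : k + 1 ≤ n) {ω η μ p q : Form n}
    (h : IsAdjProj k (cellInterior K) ω η) (hω : ω =ᵐ[volume.restrict (cellInterior K)] p)
    (hμ : μ =ᵐ[volume.restrict (cellInterior K)] q) (hp : IsQ k p) (hq : IsQs (k + 1) q) :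
    pairing k (cellInterior K) η μ = pairing k (cellInterior K) ω μ := by
  have hV := (volume_cellInterior_pos K).ne'
  obtain ⟨q', hq', h1, h2⟩ := exists_mem_P1s_mean_eq (K := K) hk hq
  -- Replacing `μ` by `q'` is harmless for every tensor product form; it is used for the interpolant
  -- and for `ω`, while the defining equations link the two at `q'`.
  have key : ∀ {ω p : Form n}, ω =ᵐ[volume.restrict (cellInterior K)] p → IsQ k p →
      pairing k (cellInterior K) ω μ = pairing k (cellInterior K) ω q' := fun hω hp => by
    refine mul_left_cancel₀ hV ?_
    rw [volume_mul_pairing hω hμ hp hq,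
      volume_mul_pairing hω (ae_eq_refl _) hp (isQs_of_mem_P1s hk hq')]
    simp only [h1, h2]
  rw [key (ae_eq_refl _) (isQ_of_mem_P1m h.1), key hω hp, h.2.1 q' hq']

end

/-! ### Green's formula by density, and summation over the mesh. -/

section

theorem HL.mono {k : ℕ} {U V : Set (Fin n → ℝ)} (hUV : U ⊆ V) (hV : MeasurableSet V)
    {ω : Form n} (h : ω ∈ HL k V) : ω ∈ HL k U :=
  ⟨h.1.mono hUV, _, (HL.isWeakD h).mono hUV hV⟩

/-- Young's inequality with weight `t`, from the squares of `t ω ± η`; the missing factor 1/2 is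
immaterial. -/
theorem abs_ip_le {k m : ℕ} {U : Set (Fin n → ℝ)} {ω η : Form n} (h : MemL2 k U ω)
    (h' : MemL2 m U η) {t : ℝ} (ht : 0 < t) : |ip U ω η| ≤ t * ip U ω ω + t⁻¹ * ip U η η := by
  unfold ip
  rw [← integral_const_mul, ← integral_const_mul,
    ← integral_add ((h.integrable h).const_mul t) ((h'.integrable h').const_mul _)]
  refine (abs_integral_le_integral_abs).trans (integral_mono (h.integrable h').abs
    (((h.integrable h).const_mul t).add ((h'.integrable h').const_mul _)) fun x => ?_)
  simp only [Finset.mul_sum]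
  rw [← Finset.sum_add_distrib]
  refine (Finset.abs_sum_le_sum_abs _ _).trans (Finset.sum_le_sum fun σ _ => ?_)
  have ht' : t * t⁻¹ = 1 := mul_inv_cancel₀ ht.ne'
  have h0 : 0 < t⁻¹ := inv_pos.2 ht
  have e1 := mul_nonneg h0.le (sq_nonneg (t * ω x σ - η x σ))
  have e2 := mul_nonneg h0.le (sq_nonneg (t * ω x σ + η x σ))
  have e3 : t⁻¹ * (t * ω x σ - η x σ) ^ 2 =
      t * (ω x σ * ω x σ) + t⁻¹ * (η x σ * η x σ) - 2 * (ω x σ * η x σ) := by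
    linear_combination (t * ω x σ ^ 2 - 2 * ω x σ * η x σ) * ht'
  have e4 : t⁻¹ * (t * ω x σ + η x σ) ^ 2 =
      t * (ω x σ * ω x σ) + t⁻¹ * (η x σ * η x σ) + 2 * (ω x σ * η x σ) := by
    linear_combination (t * ω x σ ^ 2 + 2 * ω x σ * η x σ) * ht'
  have e5 : 0 ≤ t * (ω x σ * ω x σ) + t⁻¹ * (η x σ * η x σ) :=
    add_nonneg (mul_nonneg ht.le (mul_self_nonneg _)) (mul_nonneg h0.le (mul_self_nonneg _))
  rw [abs_le]
  constructor <;> linarith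

theorem ip_self_nonneg (U : Set (Fin n → ℝ)) (ω : Form n) : 0 ≤ ip U ω ω :=
  integral_nonneg fun _ => Finset.sum_nonneg fun _ _ => mul_self_nonneg _

/-- If `(μ, ν)` is approximated by pairs `(φ, ψ)` that are orthogonal to `(α, -β)`,
then it is orthogonal itself. -/
theorem ip_sub_ip_eq_zero_of_approx {k m : ℕ} {U : Set (Fin n → ℝ)} {α β μ ν : Form n}
    (hα : MemL2 m U α) (hβ : MemL2 k U β) (hμ : MemL2 m U μ) (hν : MemL2 k U ν)
    (h : ∀ ε : ℝ, 0 < ε → ∃ φ ψ, MemL2 m U φ ∧ MemL2 k U ψ ∧ ip U α φ = ip U β ψ ∧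
      ip U (μ - φ) (μ - φ) + ip U (ν - ψ) (ν - ψ) < ε) :
    ip U α μ - ip U β ν = 0 := by
  set C := ip U α α + ip U β β
  have hC : 0 ≤ C := add_nonneg (ip_self_nonneg _ _) (ip_self_nonneg _ _)
  refine abs_eq_zero.1 (le_antisymm (le_of_forall_pos_le_add fun ε hε => ?_) (abs_nonneg _))
  -- With approximation error below `t²`, Young's inequality with weight `t` bounds the defect by `t
  -- C + t = ε`.
  set t := ε / (C + 1) with ht
  have htp : 0 < t := by positivity
  obtain ⟨φ, ψ, hφ, hψ, he, hlt⟩ := h (t * t) (mul_pos htp htp)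
  have e1 : ip U α μ - ip U β ν = ip U α (μ - φ) - ip U β (ν - ψ) := by
    rw [ip_sub_right hα hμ hφ, ip_sub_right hβ hν hψ, he]
    ring
  have h1 := abs_ip_le hα (hμ.sub hφ) htp
  have h2 := abs_ip_le hβ (hν.sub hψ) htp
  have h3 : t⁻¹ * (ip U (μ - φ) (μ - φ) + ip U (ν - ψ) (ν - ψ)) ≤ t⁻¹ * (t * t) :=
    mul_le_mul_of_nonneg_left hlt.le (inv_pos.2 htp).le
  rw [inv_mul_cancel_left₀ htp.ne'] at h3
  have h4 : t * (C + 1) = ε := div_mul_cancel₀ _ (by positivity)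
  rw [e1, zero_add]
  calc _ ≤ |ip U α (μ - φ)| + |ip U β (ν - ψ)| := abs_sub _ _
    _ ≤ t * (C + 1) := by
      simp only [C]
      linarith
    _ = ε := h4

/-- For a test form in place of `μ` this is the definition of the weak derivative of `ω`; the
graph-norm closure does the rest. -/
theorem green_of_mem_HsL0 {k : ℕ} {U : Set (Fin n → ℝ)} {ω μ : Form n} (hω : ω ∈ HL k U)
    (hμ : μ ∈ HsL0 k U) : pairing k U ω μ = 0 := by
  have hd := HL.isWeakD hω
  refine ip_sub_ip_eq_zero_of_approx hd.1 hω.1 hμ.1.1 (HsL.isWeakCod hμ.1).1 fun ε hε => ?_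
  obtain ⟨φ, hφ, h⟩ := hμ.2 ε hε
  exact ⟨φ, _, hφ.memL2, hφ.memL2_codiff, hd.2 φ hφ, h⟩

theorem green_of_mem_HL0 {k : ℕ} {U : Set (Fin n → ℝ)} {ω μ : Form n} (hω : ω ∈ HL0 k U)
    (hμ : μ ∈ HsL k U) : pairing k U ω μ = 0 := by
  have hc := HsL.isWeakCod hμ
  rw [pairing, ip_comm, ip_comm U ω, ← neg_sub, neg_eq_zero]
  refine ip_sub_ip_eq_zero_of_approx hc.1 hμ.1 hω.1.1 (HL.isWeakD hω.1).1 fun ε hε => ?_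
  obtain ⟨φ, hφ, h⟩ := hω.2 ε hε
  exact ⟨φ, _, hφ.memL2, hφ.memL2_extd, hc.2 φ hφ, h⟩

variable {Ω : Set (Fin n → ℝ)} (G : CubicalMesh Ω)

/-- The closed boxes cover `Ω`, and their faces are null sets. -/
theorem CubicalMesh.ae_eq_biUnion :
    (⋃ K ∈ G.cells, cellInterior K : Set (Fin n → ℝ)) =ᵐ[volume] Ω := by
  refine (LE.le.eventuallyLE (Set.iUnion₂_subset G.interior_subset)).antisymm ?_
  refine (LE.le.eventuallyLE G.covers).trans ?_
  have : ∀ᵐ x, ∀ K ∈ G.cells, (x ∈ cellInterior K ↔ x ∈ BoxIntegral.Box.Icc K) :=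
    (Finset.eventually_all G.cells).2 fun K _ => K.Ioo_ae_eq_Icc.mem_iff
  filter_upwards [this] with x hx h
  obtain ⟨K, hK, hxK⟩ := Set.mem_iUnion₂.1 h
  exact Set.mem_iUnion₂.2 ⟨K, hK, (hx K hK).2 hxK⟩

theorem CubicalMesh.sum_ip {k m : ℕ} {ω η : Form n} (h : MemL2 k Ω ω) (h' : MemL2 m Ω η) :
    ∑ K ∈ G.cells, ip (cellInterior K) ω η = ip Ω ω η := by
  unfold ip
  rw [← setIntegral_congr_set G.ae_eq_biUnion, integral_biUnion_finset _
    (fun K _ => (isOpen_cellInterior K).measurableSet) G.disjoint]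
  exact fun K hK => (h.mono (G.interior_subset K hK)).integrable (h'.mono (G.interior_subset K hK))

/-- No interface terms arise: the global weak derivatives restrict to the weak derivatives on each
cell. -/
theorem CubicalMesh.sum_pairing (hΩ : IsOpen Ω) {k : ℕ} {ω μ : Form n} (hω : ω ∈ HL k Ω)
    (hμ : μ ∈ HsL k Ω) :
    ∑ K ∈ G.cells, pairing k (cellInterior K) ω μ = pairing k Ω ω μ := by
  have hd := HL.isWeakD hω
  have hc := HsL.isWeakCod hμ
  rw [pairing, ← G.sum_ip hd.1 hμ.1, ← G.sum_ip hω.1 hc.1, ← Finset.sum_sub_distrib]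
  refine Finset.sum_congr rfl fun K hK => ?_
  exact pairing_congr (isOpen_cellInterior K) (ae_eq_refl _) (ae_eq_refl _)
    (hd.mono (G.interior_subset K hK) hΩ.measurableSet)
    (hc.mono (G.interior_subset K hK) hΩ.measurableSet)

theorem sum_pairing_adjProj {k : ℕ} (hk : k ≤ n) (hΩ : IsOpen Ω) {ω μ : Form n}
    (hω : ω ∈ VQ G k) (hμ : μ ∈ VQs G k) :
    ∑ K : {K // K ∈ G.cells}, pairing k (cellInterior K.1) (interp G k (toBroken G ω) K) μ =
      pairing k Ω ω μ := by
  rw [← G.sum_pairing hΩ hω.1 hμ.1,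
    ← Finset.sum_coe_sort G.cells fun K => pairing k (cellInterior K) ω μ]
  refine Finset.sum_congr rfl fun K _ => ?_
  have hK := isAdjProj_adjProj hk (HL.mono (G.interior_subset K.1 K.2) hΩ.measurableSet hω.1)
  rcases hk.lt_or_eq with h | rfl
  · obtain ⟨p, hp, hωp⟩ := hω.2 K.1 K.2
    obtain ⟨q, hq, hμq⟩ := hμ.2 K.1 K.2
    exact hK.pairing_eq h hωp hμq (isQ_of_mem_Q1m hp) (isQs_of_mem_Q1s h hq)
  -- For `k = n` the form `μ` has degree `n + 1`, hence is zero.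
  · rw [isDeg_eq_zero (Nat.lt_succ_self k) hμ.1.1.1,
      pairing_zero_right _ (isOpen_cellInterior K.1),
      pairing_zero_right _ (isOpen_cellInterior K.1)]

theorem interp_mem_P1m {k : ℕ} (hk : k ≤ n) (hΩ : IsOpen Ω) {ω : Form n} (hω : ω ∈ HL k Ω)
    (K : {K // K ∈ G.cells}) : interp G k (toBroken G ω) K ∈ P1m n k :=
  (isAdjProj_adjProj hk (HL.mono (G.interior_subset K.1 K.2) hΩ.measurableSet hω)).1

end

end CubicalWhitney

end

open CubicalWhitney
theorem mainTheorem3 (n k : ℕ) (hk : k ≤ n) (Ω : Set (Fin n → ℝ)) (hΩ : IsOpen Ω)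
    (G : CubicalMesh Ω) :
    (∀ K ∈ G.cells, ∀ ω ∈ HL k (cellInterior K),
      ∃! η, IsAdjProj k (cellInterior K) ω η) ∧
    (fun ω => interp G k (toBroken G ω)) '' VQ G k ⊆ Wdef G k ∧
    (fun ω => interp G k (toBroken G ω)) '' VQ0 G k ⊆ Wdef0 G k := by
  refine ⟨fun K _ ω hω => existsUnique_isAdjProj hk hω, ?_, ?_⟩
  · rintro _ ⟨ω, hω, rfl⟩
    refine ⟨interp_mem_P1m G hk hΩ hω.1, fun μ hμ => ?_⟩
    -- The cellwise identity ignores boundary conditions; the vanishing boundary values of `μ` enter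
    -- only through Green's formula.
    rw [sum_pairing_adjProj G hk hΩ hω ⟨hμ.1.1, hμ.2⟩, green_of_mem_HsL0 hω.1 hμ.1]
  · rintro _ ⟨ω, hω, rfl⟩
    refine ⟨interp_mem_P1m G hk hΩ hω.1.1, fun μ hμ => ?_⟩
    rw [sum_pairing_adjProj G hk hΩ ⟨hω.1.1, hω.2⟩ hμ, green_of_mem_HL0 hω.1 hμ.1]
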